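/- Let $d\ge 1$ and let $\gamma,\beta_1,\dots,\beta_d\ge 0$ satisfy $0<\gamma+\beta_j<1$ for all $1\le j\le d$. Write $\|t\|=\operatorname{dist}(t,\mathbb Z)$ for $t\in\mathbb R$, and let $\mathcal N_\delta(A)$ denote the closed $\delta$-neighborhood of $A\subset\mathbb R^d$ with respect to the maximum norm $\max_j|x_j|$. For a sequence $\{q_i\}_{i\ge 1}$ of positive real numbers put $$E=\bigcap_{i\ge 1}\bigl\{x\in\mathbb R^d:\ \text{there is an integer } 1\le H\le q_i^{\gamma} \text{ such that } \|Hq_i^{\beta_j}x_j\|\le Hq_i^{\beta_j-1}\ \text{for all } 1\le j\le d\bigr\}.$$ Then $$E=\bigcap_{i\ge1}\ \bigcup_{1\le H\le q_i^\gamma}\mathcal N_{q_i^{-1}}\left(\frac{\mathbb Z}{Hq_i^{\beta_1}}\times\cdots\times\frac{\mathbb Z}{Hq_i^{\beta_d}}\right),$$ where $H$ runs over integers, and there exists an increasing sequence $\{q_i\}_{i\ge 1}$ of positive real numbers such that $E$ has Hausdorff dimension $$\min\Bigl\{(d+1)\gamma+\sum_{j=1}^d\beta_j,\ d\Bigr\}.$$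 In particular, $E$ has this Hausdorff dimension for every increasing sequence $\{q_i\}_{i\ge1}$ in $(1,\infty)$ that satisfies $$q_i>\max\bigl\{q_{i-1}^{10di},\ q_{i-1}^{1/(\gamma+\beta_j)}\ (1\le j\le d)\bigr\}\qquad\text{for all } i\ge 2.$$ -/

import Mathlib

noncomputable section

namespace DiophantineLiminf

/-- The distance `‖t‖ = dist(t, ℤ)` of a real number to the nearest integer. -/
def distInt (t : ℝ) : ℝ :=
  Metric.infDist t (Set.range (fun m : ℤ => (m : ℝ)))

/-- The points `x ∈ ℝ^d` such that, for some integer `1 ≤ H ≤ q ^ γ`,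
`‖H q^{β_j} x_j‖ ≤ H q^{β_j - 1}` for all `j` (the same `H` for all coordinates). -/
def approxLevel {d : ℕ} (γ : ℝ) (β : Fin d → ℝ) (q : ℝ) : Set (EuclideanSpace ℝ (Fin d)) :=
  {x | ∃ H : ℕ, 1 ≤ H ∧ (H : ℝ) ≤ q ^ γ ∧
    ∀ j, distInt ((H : ℝ) * q ^ β j * x j) ≤ (H : ℝ) * q ^ (β j - 1)}

/-- The set `⋂_{i ≥ 1} {x : ‖H q_i^{β_j} x_j‖ ≤ H q_i^{β_j - 1} ∀ j, for some 1 ≤ H ≤ q_i^γ}`. -/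
def approxSet {d : ℕ} (γ : ℝ) (β : Fin d → ℝ) (q : ℕ → ℝ) : Set (EuclideanSpace ℝ (Fin d)) :=
  ⋂ i ∈ Set.Ici (1 : ℕ), approxLevel γ β (q i)

/-- The lattice `ℤ/(H q^{β_1}) × ⋯ × ℤ/(H q^{β_d})` in `ℝ^d`. -/
def lattice {d : ℕ} (β : Fin d → ℝ) (q : ℝ) (H : ℕ) : Set (EuclideanSpace ℝ (Fin d)) :=
  {x | ∀ j, ∃ m : ℤ, x j = (m : ℝ) / ((H : ℝ) * q ^ β j)}

/-- The closed `δ`-neighborhood of `A ⊆ ℝ^d` for the maximum norm (so that the neighborhood of a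
point is a closed cube of side `2δ`): `Fin d → ℝ` carries the distance `max_j |x_j - y_j|`. -/
def cubeNhd {d : ℕ} (δ : ℝ) (A : Set (EuclideanSpace ℝ (Fin d))) :
    Set (EuclideanSpace ℝ (Fin d)) :=
  {x | WithLp.ofLp x ∈ Metric.cthickening δ ((fun y => WithLp.ofLp y) '' A : Set (Fin d → ℝ))}

/-- The set `⋂_{i ≥ 1} ⋃_{1 ≤ H ≤ q_i^γ} N_{1/q_i}(ℤ/(H q_i^{β_1}) × ⋯ × ℤ/(H q_i^{β_d}))`. -/
def latticeSet {d : ℕ} (γ : ℝ) (β : Fin d → ℝ) (q : ℕ → ℝ) : Set (EuclideanSpace ℝ (Fin d)) :=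
  ⋂ i ∈ Set.Ici (1 : ℕ), ⋃ H ∈ {H : ℕ | 1 ≤ H ∧ (H : ℝ) ≤ q i ^ γ},
    cubeNhd (q i)⁻¹ (lattice β (q i) H)

/-- The explicit growth condition on `q_1 < q_2 < ⋯` in `(1, ∞)`:
`q_i > max {q_{i-1}^{10 d i}, q_{i-1}^{1/(γ+β_j)}, 1 ≤ j ≤ d}` for all `i ≥ 2`
(written with `i + 1` in place of `i`). -/
def GrowsFast {d : ℕ} (γ : ℝ) (β : Fin d → ℝ) (q : ℕ → ℝ) : Prop :=
  (∀ i, 1 ≤ i → 1 < q i) ∧ StrictMonoOn q (Set.Ici 1) ∧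
    ∀ i, 1 ≤ i → q i ^ (10 * d * (i + 1)) < q (i + 1) ∧
      ∀ j, q i ^ (1 / (γ + β j)) < q (i + 1)

end DiophantineLiminf

end

open Set Filter Topology MeasureTheory Measure
open scoped NNReal ENNReal

namespace DiophantineLiminf

/-! Write s = (d+1)γ + Σβ_j. Upper bound: on a bounded region one level q alone covers E by O(q^s)
cubes of side 2/q, namely q^γ choices of H times O(q^(γ+β_j)) numerators per coordinate. Letting q
tend to infinity gives dimension at most s.

Lower bound: fix τ < t₀ < t < min(s, d). Inside a cube of radius ℓ = 1/q_i, consider the reduced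
fractions p_j/(H q^β_j) at level q = q_(i+1), with H prime and only slightly smaller than q^γ (H = 1
if γ = 0). The key estimate (`sum_card_close_le_rpow`) says that at most a constant times N²(r/ℓ)^t
of the N² pairs are r-close, for 1/q ≤ r ≤ ℓ. At coarse scales each lattice is equidistributed. At
fine scales, two distinct primes H, H' give a nonzero integer pH' - p'H of size at most rHH'q^β_j,
which limits the pairs, and pairs with the same H are too few to matter. The growth of q makes ℓ
larger than any fixed negative power of q, so losses in ℓ are harmless.

A Markov argument (`exists_regular_subset`) then selects fractions around which balls of every
dyadic scale hold at most their t₀-dimensional share. The cubes about them are the children in a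
Cantor construction. Its Hausdorff measure is bounded below without building a measure
(`one_le_tsum_weight`): given a cover of small total weight, averaging always finds a child whose
weight is no larger, and the limit of the nested cubes is a point that the cover misses. -/

/-! ### Descriptions of the set, and passage to the maximum norm -/

theorem distInt_le_iff {t r : ℝ} : distInt t ≤ r ↔ ∃ m : ℤ, |t - m| ≤ r := by
  have hne : (Set.range (fun m : ℤ => (m : ℝ))).Nonempty := Set.range_nonempty _
  constructor
  · intro h
    obtain ⟨y, ⟨m, rfl⟩, hm⟩ :=
      Int.isClosedEmbedding_coe_real.isClosed_range.exists_infDist_eq_dist hne t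
    refine ⟨m, ?_⟩
    rw [← Real.dist_eq, ← hm]
    exact h
  · rintro ⟨m, hm⟩
    exact (Metric.infDist_le_dist_of_mem (Set.mem_range_self m)).trans (by rwa [Real.dist_eq])

theorem abs_mul_sub_le_mul_iff {D x δ m : ℝ} (hD : 0 < D) :
    |D * x - m| ≤ D * δ ↔ |x - m / D| ≤ δ := by
  have : D * x - m = D * (x - m / D) := by field_simp
  rw [this, abs_mul, abs_of_pos hD, mul_le_mul_iff_right₀ hD]

theorem mem_approxLevel_iff {d : ℕ} {γ : ℝ} {β : Fin d → ℝ} {q : ℝ} (hq : 0 < q)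
    {x : EuclideanSpace ℝ (Fin d)} :
    x ∈ approxLevel γ β q ↔ ∃ H : ℕ, 1 ≤ H ∧ (H : ℝ) ≤ q ^ γ ∧
      ∃ p : Fin d → ℤ, ∀ j, |x j - p j / (H * q ^ β j)| ≤ q⁻¹ := by
  simp only [approxLevel, mem_ofPred_eq]
  refine exists_congr fun H => and_congr_right fun hH => and_congr_right fun _ => ?_
  have hH' : (0 : ℝ) < H := by exact_mod_cast hH
  rw [← Classical.skolem (p := fun j (m : ℤ) => |x j - m / (H * q ^ β j)| ≤ q⁻¹)]
  refine forall_congr' fun j => ?_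
  have hD : 0 < (H : ℝ) * q ^ β j := mul_pos hH' (Real.rpow_pos_of_pos hq _)
  rw [distInt_le_iff]
  refine exists_congr fun m => ?_
  rw [← abs_mul_sub_le_mul_iff hD, Real.rpow_sub_one hq.ne', div_eq_mul_inv, mul_assoc]
  simp only [mul_assoc]

theorem mem_cubeNhd_lattice_iff {d : ℕ} {β : Fin d → ℝ} {q : ℝ} (hq : 0 < q) {H : ℕ} (hH : 1 ≤ H)
    {x : EuclideanSpace ℝ (Fin d)} :
    x ∈ cubeNhd q⁻¹ (lattice β q H) ↔
      ∃ p : Fin d → ℤ, ∀ j, |x j - p j / (H * q ^ β j)| ≤ q⁻¹ := by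
  have hH' : (0 : ℝ) < H := by exact_mod_cast hH
  have hq' : 0 ≤ q⁻¹ := by positivity
  constructor
  · intro h
    rw [← Classical.skolem (p := fun j (m : ℤ) => |x j - m / (H * q ^ β j)| ≤ q⁻¹)]
    intro j
    have hD : 0 < (H : ℝ) * q ^ β j := mul_pos hH' (Real.rpow_pos_of_pos hq _)
    suffices h2 : distInt (H * q ^ β j * x j) ≤ H * q ^ β j * q⁻¹ by
      obtain ⟨m, hm⟩ := distInt_le_iff.1 h2
      exact ⟨m, (abs_mul_sub_le_mul_iff hD).1 hm⟩
    -- Closed thickening only provides lattice points up to an error; closedness of ℤ, through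
    -- `distInt_le_iff`, recovers an exact one. Dividing ε by the denominator makes the error ε
    -- after rescaling.
    refine le_of_forall_pos_le_add fun ε hε => ?_
    have h1 : WithLp.ofLp x ∈ Metric.thickening (q⁻¹ + ε / (H * q ^ β j))
        ((fun y => WithLp.ofLp y) '' lattice β q H : Set (Fin d → ℝ)) :=
      Metric.cthickening_subset_thickening' (by positivity)
        (lt_add_of_pos_right _ (by positivity)) _ h
    obtain ⟨_, ⟨y, hy, rfl⟩, hxy⟩ := Metric.mem_thickening_iff.1 h1
    obtain ⟨m, hm⟩ := hy j
    refine distInt_le_iff.2 ⟨m, ?_⟩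
    have h3 : |x j - m / (H * q ^ β j)| ≤ q⁻¹ + ε / (H * q ^ β j) := by
      rw [← hm, ← Real.dist_eq]
      exact (dist_le_pi_dist (WithLp.ofLp x) (WithLp.ofLp y) j).trans hxy.le
    refine ((abs_mul_sub_le_mul_iff hD).2 h3).trans (le_of_eq ?_)
    field_simp
  · rintro ⟨p, hp⟩
    refine Metric.mem_cthickening_of_dist_le (WithLp.ofLp x) (fun j => p j / (H * q ^ β j)) _ _
      ⟨WithLp.toLp 2 fun j => p j / (H * q ^ β j), fun j => ⟨p j, rfl⟩, rfl⟩ ?_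
    exact (dist_pi_le_iff hq').2 fun j => by rw [Real.dist_eq]; exact hp j

theorem approxSet_eq_latticeSet {d : ℕ} (γ : ℝ) (β : Fin d → ℝ) (q : ℕ → ℝ)
    (hq : ∀ i, 1 ≤ i → 0 < q i) : approxSet γ β q = latticeSet γ β q := by
  refine iInter₂_congr fun i hi => ?_
  ext x
  rw [mem_approxLevel_iff (hq i hi)]
  simp only [mem_iUnion, mem_ofPred_eq, exists_prop, and_assoc]
  refine exists_congr fun H => and_congr_right fun hH => and_congr_right fun _ => ?_
  rw [mem_cubeNhd_lattice_iff (hq i hi) hH]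

/-- The approximation set, as a subset of `ℝ^d` with the maximum norm. -/
def supSet {d : ℕ} (γ : ℝ) (β : Fin d → ℝ) (q : ℕ → ℝ) : Set (Fin d → ℝ) :=
  {x | ∀ i, 1 ≤ i → ∃ H : ℕ, 1 ≤ H ∧ (H : ℝ) ≤ q i ^ γ ∧
    ∃ p : Fin d → ℤ, ∀ j, |x j - p j / (H * q i ^ β j)| ≤ (q i)⁻¹}

theorem dimH_approxSet {d : ℕ} (γ : ℝ) (β : Fin d → ℝ) (q : ℕ → ℝ)
    (hq : ∀ i, 1 ≤ i → 0 < q i) : dimH (approxSet γ β q) = dimH (supSet γ β q) := by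
  rw [← (EuclideanSpace.equiv (Fin d) ℝ).dimH_preimage]
  congr 1
  ext x
  simp only [approxSet, mem_iInter, mem_preimage, supSet, mem_ofPred_eq, mem_Ici]
  exact forall₂_congr fun i hi => mem_approxLevel_iff (hq i hi)

/-! ### Growth of the sequence -/

theorem GrowsFast.sq_le {d : ℕ} (hd : 1 ≤ d) {γ : ℝ} {β : Fin d → ℝ} {q : ℕ → ℝ}
    (h : GrowsFast γ β q) {i : ℕ} (hi : 1 ≤ i) : q i ^ 2 ≤ q (i + 1) := by
  refine le_trans (pow_le_pow_right₀ (h.1 i hi).le ?_) (h.2.2 i hi).1.le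
  nlinarith

theorem GrowsFast.tendsto {d : ℕ} (hd : 1 ≤ d) {γ : ℝ} {β : Fin d → ℝ} {q : ℕ → ℝ}
    (h : GrowsFast γ β q) : Tendsto q atTop atTop := by
  have h1 := h.1 1 le_rfl
  have key : ∀ n : ℕ, q 1 ^ n ≤ q (n + 1) := by
    intro n
    induction n with
    | zero => simpa using h1.le
    | succ n ih =>
      have h2 := h.sq_le hd (i := n + 1) (by omega)
      have h3 := h.2.1.monotoneOn (a := 1) (b := n + 1) (by simp) (by simp) (by omega)
      have h4 : 0 < q (n + 1) := by linarith
      rw [pow_succ]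
      nlinarith [mul_le_mul ih h3 (by linarith) h4.le]
  rw [← tendsto_add_atTop_iff_nat 1]
  exact tendsto_atTop_mono key (tendsto_pow_atTop_atTop_of_one_lt h1)

theorem exists_growsFast {d : ℕ} (γ : ℝ) (β : Fin d → ℝ) : ∃ q : ℕ → ℝ, GrowsFast γ β q := by
  let F : ℕ → ℝ → ℝ := fun i x => x ^ (10 * d * (i + 1)) + ∑ j, x ^ (1 / (γ + β j)) + x
  let q : ℕ → ℝ := fun n => Nat.rec 2 F n
  have hs : ∀ i, q (i + 1) = F i (q i) := fun i => rfl
  have hF : ∀ i x, 1 < x → x < F i x ∧ x ^ (10 * d * (i + 1)) < F i x ∧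
      ∀ j, x ^ (1 / (γ + β j)) < F i x := by
    intro i x hx
    have h0 : 0 < x := by linarith
    have h1 : 0 < x ^ (10 * d * (i + 1)) := by positivity
    have h2 : ∀ j ∈ Finset.univ, 0 ≤ x ^ (1 / (γ + β j)) := fun j _ => by positivity
    have h3 := Finset.sum_nonneg h2
    refine ⟨by simp only [F]; linarith, by simp only [F]; linarith, fun j => ?_⟩
    have := Finset.single_le_sum h2 (Finset.mem_univ j)
    simp only [F]; linarith
  have h1 : ∀ i, 1 < q i := by
    intro i
    induction i with
    | zero => change (1 : ℝ) < 2; norm_num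
    | succ n ih => rw [hs]; exact ih.trans (hF n _ ih).1
  exact ⟨q, fun i _ => h1 i, (strictMono_nat_of_lt_succ fun i => by
    rw [hs]; exact (hF i _ (h1 i)).1).strictMonoOn _, fun i _ => by
    rw [hs]; exact (hF i _ (h1 i)).2⟩

/-! ### Upper bound by covering -/

theorem supSet_inter_closedBall_subset {d : ℕ} {γ : ℝ} {β : Fin d → ℝ} (q : ℕ → ℝ) {i : ℕ}
    (hi : 1 ≤ i) (hq : 1 < q i) (N : ℕ) :
    supSet γ β q ∩ Metric.closedBall 0 N ⊆
      ⋃ a : (Finset.Icc 1 ⌊q i ^ γ⌋₊ ×ˢ Fintype.piFinset fun j =>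
        Finset.Icc (-⌊((N : ℝ) + 1) * q i ^ (γ + β j)⌋) ⌊((N : ℝ) + 1) * q i ^ (γ + β j)⌋ :
          Finset (ℕ × (Fin d → ℤ))),
        Metric.closedBall (fun j => (a.1.2 j : ℝ) / (a.1.1 * q i ^ β j)) (q i)⁻¹ := by
  rintro x ⟨hx, hxN⟩
  obtain ⟨H, hH, hHq, p, hp⟩ := hx i hi
  have hq0 : 0 < q i := by linarith
  have hH' : (0 : ℝ) < H := by exact_mod_cast hH
  have hqi : (q i)⁻¹ ≤ 1 := inv_le_one_of_one_le₀ hq.le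
  have hpb : ∀ j, |(p j : ℝ)| ≤ ((N : ℝ) + 1) * q i ^ (γ + β j) := by
    intro j
    have hw : 0 < q i ^ β j := Real.rpow_pos_of_pos hq0 _
    have hD : 0 < (H : ℝ) * q i ^ β j := by positivity
    have h1 : |x j| ≤ N := by
      have := dist_le_pi_dist x 0 j
      rw [Real.dist_eq, Pi.zero_apply, sub_zero] at this
      exact this.trans (Metric.mem_closedBall.1 hxN)
    have h2 : |(p j : ℝ) / (H * q i ^ β j)| ≤ N + 1 := by
      have := abs_sub_abs_le_abs_sub ((p j : ℝ) / (H * q i ^ β j)) (x j)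
      rw [abs_sub_comm] at this
      linarith [hp j]
    rw [abs_div, abs_of_pos hD, div_le_iff₀ hD] at h2
    refine h2.trans ?_
    rw [Real.rpow_add hq0]
    gcongr
  refine mem_iUnion.2 ⟨⟨(H, p), ?_⟩, ?_⟩
  · simp only [Finset.mem_product, Finset.mem_Icc, Fintype.mem_piFinset]
    refine ⟨⟨hH, Nat.le_floor hHq⟩, fun j => ?_⟩
    obtain ⟨h1, h2⟩ := abs_le.1 (hpb j)
    refine ⟨?_, Int.le_floor.2 h2⟩
    rw [neg_le, Int.le_floor]
    push_cast
    linarith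
  · rw [Metric.mem_closedBall, dist_pi_le_iff (by positivity)]
    intro j
    rw [Real.dist_eq]
    exact hp j

theorem card_cover_le {d : ℕ} {γ : ℝ} {β : Fin d → ℝ} (hγ : 0 ≤ γ) (hβ : ∀ j, 0 ≤ β j)
    {q : ℝ} (hq : 1 < q) (N : ℕ) :
    ((Finset.Icc 1 ⌊q ^ γ⌋₊ ×ˢ Fintype.piFinset fun j =>
        Finset.Icc (-⌊((N : ℝ) + 1) * q ^ (γ + β j)⌋) ⌊((N : ℝ) + 1) * q ^ (γ + β j)⌋ :
          Finset (ℕ × (Fin d → ℤ))).card : ℝ) ≤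
      (2 * N + 3) ^ d * q ^ (((d : ℝ) + 1) * γ + ∑ j, β j) := by
  have hq0 : 0 < q := by linarith
  rw [Finset.card_product, Fintype.card_piFinset, Nat.card_Icc]
  push_cast
  have h1 : ((⌊q ^ γ⌋₊ + 1 - 1 : ℕ) : ℝ) ≤ q ^ γ := by
    rw [Nat.add_sub_cancel]
    exact Nat.floor_le (by positivity)
  have h2 : ∀ j ∈ Finset.univ, ((Finset.Icc (-⌊((N : ℝ) + 1) * q ^ (γ + β j)⌋)
      ⌊((N : ℝ) + 1) * q ^ (γ + β j)⌋).card : ℝ) ≤ (2 * N + 3) * q ^ (γ + β j) := by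
    intro j _
    have h3 : 1 ≤ q ^ (γ + β j) := Real.one_le_rpow hq.le (by linarith [hβ j])
    have h4 : (0 : ℤ) ≤ ⌊((N : ℝ) + 1) * q ^ (γ + β j)⌋ := Int.floor_nonneg.2 (by positivity)
    have h5 := Int.floor_le (((N : ℝ) + 1) * q ^ (γ + β j))
    rw [Int.card_Icc]
    have h6 : (((⌊((N : ℝ) + 1) * q ^ (γ + β j)⌋ + 1 - -⌊((N : ℝ) + 1) * q ^ (γ + β j)⌋).toNat : ℤ)
        : ℝ) = 2 * ⌊((N : ℝ) + 1) * q ^ (γ + β j)⌋ + 1 := by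
      rw [Int.toNat_of_nonneg (by omega)]
      push_cast; ring
    rw [Int.cast_natCast] at h6
    rw [h6]
    nlinarith
  have h7 : q ^ (((d : ℝ) + 1) * γ + ∑ j, β j) = q ^ γ * ∏ j, q ^ (γ + β j) := by
    rw [← Real.rpow_sum_of_pos hq0, ← Real.rpow_add hq0, Finset.sum_add_distrib]
    simp
    ring_nf
  calc _ ≤ q ^ γ * ∏ j, ((2 * N + 3) * q ^ (γ + β j)) :=
        mul_le_mul h1 (Finset.prod_le_prod (fun _ _ => by positivity) h2)
          (by positivity) (by positivity)
    _ = _ := by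
        rw [Finset.prod_mul_distrib, h7]
        simp
        ring

/-- The cover at level i has O(q_i^s) cubes of diameter at most 2/q_i, so its t-sum is O(q_i^(s-t)),
which tends to 0. -/
theorem hausdorffMeasure_supSet_inter_closedBall {d : ℕ} {γ : ℝ} {β : Fin d → ℝ} (hγ : 0 ≤ γ)
    (hβ : ∀ j, 0 ≤ β j) {q : ℕ → ℝ} (hq : ∀ i, 1 ≤ i → 1 < q i) (hq' : Tendsto q atTop atTop)
    {t : ℝ} (ht : ((d : ℝ) + 1) * γ + ∑ j, β j < t) (N : ℕ) :
    μH[t] (supSet γ β q ∩ Metric.closedBall 0 N) = 0 := by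
  set s := ((d : ℝ) + 1) * γ + ∑ j, β j with hs
  have hs0 : 0 ≤ s := add_nonneg (by positivity) (Finset.sum_nonneg fun j _ => hβ j)
  have ht0 : 0 < t := by linarith
  have hinv : Tendsto (fun i => ENNReal.ofReal (2 * (q i)⁻¹)) atTop (𝓝 0) := by
    have := (tendsto_inv_atTop_zero.comp hq').const_mul 2
    simpa using ENNReal.tendsto_ofReal this
  have hdiam : ∀ᶠ i in atTop, ∀ y : Fin d → ℝ,
      Metric.ediam (Metric.closedBall y (q i)⁻¹) ≤ ENNReal.ofReal (2 * (q i)⁻¹) := by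
    filter_upwards [eventually_ge_atTop 1] with i hi y
    refine Metric.ediam_le_of_forall_dist_le fun a ha b hb => ?_
    have := dist_triangle_right a b y
    rw [Metric.mem_closedBall] at ha hb
    linarith
  have hle := hausdorffMeasure_le_liminf_sum t (supSet γ β q ∩ Metric.closedBall 0 (N : ℝ))
    _ hinv (fun i (a : (Finset.Icc 1 ⌊q i ^ γ⌋₊ ×ˢ Fintype.piFinset fun j =>
        Finset.Icc (-⌊((N : ℝ) + 1) * q i ^ (γ + β j)⌋) ⌊((N : ℝ) + 1) * q i ^ (γ + β j)⌋ :
          Finset (ℕ × (Fin d → ℤ)))) =>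
        Metric.closedBall (fun j => (a.1.2 j : ℝ) / (a.1.1 * q i ^ β j)) (q i)⁻¹)
    (hdiam.mono fun i h a => h _)
    ((eventually_ge_atTop 1).mono fun i hi => supSet_inter_closedBall_subset q hi (hq i hi) N)
  refine le_antisymm (hle.trans ?_) zero_le
  have hlim : Tendsto (fun i => ENNReal.ofReal ((2 * N + 3) ^ d * 2 ^ t * q i ^ (-(t - s))))
      atTop (𝓝 0) := by
    have := ((tendsto_rpow_neg_atTop (sub_pos.2 ht)).comp hq').const_mul
      ((2 * (N : ℝ) + 3) ^ d * 2 ^ t)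
    simpa using ENNReal.tendsto_ofReal this
  rw [← hlim.liminf_eq]
  refine liminf_le_liminf ?_
  filter_upwards [hdiam, eventually_ge_atTop 1] with i hi hi1
  have hq1 := hq i hi1
  have hq0 : 0 < q i := by linarith
  refine (Finset.sum_le_card_nsmul _ _ (ENNReal.ofReal (2 * (q i)⁻¹) ^ t)
    fun a _ => ENNReal.rpow_le_rpow (hi _) ht0.le).trans ?_
  rw [ENNReal.ofReal_rpow_of_pos (by positivity), nsmul_eq_mul, ← ENNReal.ofReal_natCast,
    ← ENNReal.ofReal_mul (by positivity), Finset.card_univ, Fintype.card_coe]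
  refine ENNReal.ofReal_le_ofReal ?_
  refine (mul_le_mul_of_nonneg_right (card_cover_le hγ hβ hq1 N) (by positivity)).trans
    (le_of_eq ?_)
  rw [Real.mul_rpow (by norm_num) (by positivity), Real.inv_rpow hq0.le, neg_sub,
    Real.rpow_sub hq0]
  field_simp
  rfl

theorem dimH_supSet_le {d : ℕ} {γ : ℝ} {β : Fin d → ℝ} (hγ : 0 ≤ γ)
    (hβ : ∀ j, 0 ≤ β j) {q : ℕ → ℝ} (hq : ∀ i, 1 ≤ i → 1 < q i) (hq' : Tendsto q atTop atTop) :
    dimH (supSet γ β q) ≤ ENNReal.ofReal (((d : ℝ) + 1) * γ + ∑ j, β j) := by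
  have hU : supSet γ β q = ⋃ N : ℕ, supSet γ β q ∩ Metric.closedBall 0 N := by
    rw [← inter_iUnion, Metric.iUnion_closedBall_nat, inter_univ]
  rw [hU, dimH_iUnion]
  refine iSup_le fun N => le_of_forall_gt_imp_ge_of_dense fun a ha => ?_
  obtain ⟨t, ht1, ht2⟩ := ENNReal.lt_iff_exists_nnreal_btwn.1 ha
  refine le_trans (dimH_le_of_hausdorffMeasure_ne_top ?_) ht2.le
  rw [hausdorffMeasure_supSet_inter_closedBall hγ hβ hq hq' _ N]
  · simp
  · rw [← ENNReal.ofReal_coe_nnreal] at ht1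
    exact (ENNReal.ofReal_lt_ofReal_iff_of_nonneg (add_nonneg (by positivity)
      (Finset.sum_nonneg fun j _ => hβ j))).1 ht1

/-! ### Hausdorff measure of Cantor sets by following weights -/

/-- The weight of a set of diameter `r` at scale `ρ`. -/
noncomputable def weight (C τ ρ r : ℝ) : ℝ := min 1 (C * (r / ρ) ^ τ)

/-- One covering set, seen from a parent with n children of which it meets m: the total weight over
the children is at most n times the weight at the parent. If r ≥ ρ', the count alone suffices since
t > τ. If r < ρ', the second factor C is paid for by (ρ'/ρ)^(t-τ), which is `hsmall`. -/
theorem card_mul_weight_le {C t τ ρ ρ' r n m : ℝ} (hC : 1 ≤ C) (hτ : 0 < τ) (hτt : τ < t)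
    (hρ : 0 < ρ) (hρ' : 0 < ρ') (hr : 0 < r)
    (hsmall : C * (ρ' / ρ) ^ (t - τ) ≤ 1) (hm : 0 ≤ m) (hmn : m ≤ n)
    (h : m ≤ C * n * (max r ρ' / ρ) ^ t) :
    m * weight C τ ρ' r ≤ n * weight C τ ρ r := by
  have hn : 0 ≤ n := hm.trans hmn
  have hw1 : weight C τ ρ' r ≤ 1 := min_le_left _ _
  have hw0 : 0 ≤ weight C τ ρ' r := le_min zero_le_one (by positivity)
  have h1 : m * weight C τ ρ' r ≤ n := by nlinarith
  have h2 : m * weight C τ ρ' r ≤ n * (C * (r / ρ) ^ τ) := by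
    rcases le_total ρ' r with hr' | hr'
    · rw [max_eq_left hr'] at h
      rcases le_total ρ r with hρr | hρr
      · have h3 : 1 ≤ (r / ρ) ^ τ := Real.one_le_rpow ((one_le_div hρ).2 hρr) hτ.le
        nlinarith [mul_le_mul hC h3 zero_le_one (by linarith)]
      · have h3 : (r / ρ) ^ t ≤ (r / ρ) ^ τ :=
          Real.rpow_le_rpow_of_exponent_ge (by positivity) ((div_le_one hρ).2 hρr) hτt.le
        calc m * weight C τ ρ' r ≤ m := by nlinarith
          _ ≤ C * n * (r / ρ) ^ t := h
          _ ≤ C * n * (r / ρ) ^ τ := by gcongr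
          _ = _ := by ring
    · rw [max_eq_right hr'] at h
      have h3 : (ρ' / ρ) ^ t * (r / ρ') ^ τ = (ρ' / ρ) ^ (t - τ) * (r / ρ) ^ τ := by
        have : r / ρ = (ρ' / ρ) * (r / ρ') := by field_simp
        rw [this, Real.mul_rpow (by positivity) (by positivity), ← mul_assoc,
          ← Real.rpow_add (by positivity)]
        simp
      calc m * weight C τ ρ' r ≤ (C * n * (ρ' / ρ) ^ t) * (C * (r / ρ') ^ τ) :=
            mul_le_mul h (min_le_right _ _) hw0 (by positivity)
        _ = (n * (C * (r / ρ) ^ τ)) * (C * (ρ' / ρ) ^ (t - τ)) := by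
            linear_combination C * C * n * h3
        _ ≤ (n * (C * (r / ρ) ^ τ)) * 1 := by gcongr
        _ = _ := mul_one _
  rw [weight, weight] at *
  rcases min_cases 1 (C * (r / ρ) ^ τ) with h5 | h5 <;> rw [h5.1]
  · rwa [mul_one]
  · exact h2

/-- The total weight at scale `ρ` of those sets of a family that meet the ball of radius `ρ`
about `c`. -/
noncomputable def potential {X : Type*} [MetricSpace X] (C τ : ℝ) (U : ℕ → Set X) (r : ℕ → ℝ) (ρ : ℝ) (c : X) :
    ℝ≥0∞ :=
  ∑' n, {c | (Metric.closedBall c ρ ∩ U n).Nonempty}.indicator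
    (fun _ => ENNReal.ofReal (weight C τ ρ (r n))) c

/-- A ball of radius `ρ` has descendants of radius `ρ'` inside the set `F` that are distributed in
a `t`-dimensional way. -/
def HasChildren {X : Type*} [MetricSpace X] (ι : Type*) (C t ρ ρ' : ℝ) (F : Set X) (c : X) :
    Prop :=
  ∃ (S : Finset ι) (y : ι → X), S.Nonempty ∧
    (∀ a ∈ S, Metric.closedBall (y a) ρ' ⊆ Metric.closedBall c ρ ∧
      Metric.closedBall (y a) ρ' ⊆ F) ∧
    ∀ (U : Set X) (r : ℝ), 0 < r → (∀ u ∈ U, ∀ v ∈ U, dist u v ≤ r) →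
      ({a ∈ (S : Set ι) | (Metric.closedBall (y a) ρ' ∩ U).Nonempty}.ncard : ℝ) ≤
        C * S.card * (max r ρ' / ρ) ^ t

/-- Sum the potentials over all children and exchange sums: by `card_mul_weight_le` the average is
at most the parent's potential, so some child does not exceed it. A set that meets a child also
meets the parent. -/
theorem HasChildren.exists_potential_le {X ι : Type*} [MetricSpace X] {C t τ ρ ρ' : ℝ} {F : Set X}
    {c : X} (h : HasChildren ι C t ρ ρ' F c) (hC : 1 ≤ C) (hτ : 0 < τ) (hτt : τ < t)
    (hρ : 0 < ρ) (hρ' : 0 < ρ') (hsmall : C * (ρ' / ρ) ^ (t - τ) ≤ 1)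
    {U : ℕ → Set X} {r : ℕ → ℝ} (hr : ∀ n, 0 < r n)
    (hU : ∀ n, ∀ u ∈ U n, ∀ v ∈ U n, dist u v ≤ r n) :
    ∃ c', Metric.closedBall c' ρ' ⊆ Metric.closedBall c ρ ∧ Metric.closedBall c' ρ' ⊆ F ∧
      potential C τ U r ρ' c' ≤ potential C τ U r ρ c := by
  classical
  obtain ⟨S, y, hS, hsub, hcount⟩ := h
  by_contra! hcon
  have hlt : ∑ _a ∈ S, potential C τ U r ρ c < ∑ a ∈ S, potential C τ U r ρ' (y a) :=
    ENNReal.sum_lt_sum_of_nonempty hS fun a ha => hcon (y a) (hsub a ha).1 (hsub a ha).2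
  refine absurd hlt (not_lt.2 ?_)
  simp only [potential]
  rw [← Summable.tsum_finsetSum fun _ _ => ENNReal.summable, Finset.sum_const, nsmul_eq_mul,
    ← ENNReal.tsum_mul_left]
  refine ENNReal.tsum_le_tsum fun n => ?_
  have hset : {a ∈ (S : Set ι) | (Metric.closedBall (y a) ρ' ∩ U n).Nonempty} =
      (S.filter fun a => (Metric.closedBall (y a) ρ' ∩ U n).Nonempty : Finset ι) := by
    ext a; simp
  have hc := hcount (U n) (r n) (hr n) (hU n)
  rw [hset, ncard_coe_finset] at hc
  simp only [indicator_apply, mem_ofPred_eq]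
  rw [← Finset.sum_filter, Finset.sum_const, nsmul_eq_mul]
  by_cases hmeet : (Metric.closedBall c ρ ∩ U n).Nonempty
  · rw [if_pos hmeet, ← ENNReal.ofReal_natCast, ← ENNReal.ofReal_natCast,
      ← ENNReal.ofReal_mul (by positivity), ← ENNReal.ofReal_mul (by positivity)]
    exact ENNReal.ofReal_le_ofReal (card_mul_weight_le hC hτ hτt hρ hρ' (hr n) hsmall
      (by positivity) (by exact_mod_cast Finset.card_filter_le _ _) hc)
  · rw [Finset.filter_eq_empty_iff.2]
    · simp
    · exact fun a ha hne => hmeet (hne.mono (inter_subset_inter_left _ (hsub a ha).1))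

/-- If the sum were below 1, nested balls of potential below 1 could be chosen forever. Their common
point lies in some U n, and once the radius drops below r n that set alone contributes weight 1. -/
theorem one_le_tsum_weight {X ι : Type*} [MetricSpace X] [CompleteSpace X] {C t τ : ℝ}
    {ρ : ℕ → ℝ} (hC : 1 ≤ C) (hτ : 0 < τ) (hτt : τ < t) (hρ : ∀ i, 0 < ρ i)
    (hρ0 : Tendsto ρ atTop (𝓝 0)) (hsmall : ∀ i, C * (ρ (i + 1) / ρ i) ^ (t - τ) ≤ 1)
    {F : ℕ → Set X} (hchild : ∀ i c, HasChildren ι C t (ρ i) (ρ (i + 1)) (F i) c) (x₀ : X)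
    {U : ℕ → Set X} {r : ℕ → ℝ} (hr : ∀ n, 0 < r n)
    (hU : ∀ n, ∀ u ∈ U n, ∀ v ∈ U n, dist u v ≤ r n)
    (hcov : Metric.closedBall x₀ (ρ 0) ∩ ⋂ i, F i ⊆ ⋃ n, U n) :
    1 ≤ ∑' n, ENNReal.ofReal (weight C τ (ρ 0) (r n)) := by
  by_contra! hlt
  have hpot0 : potential C τ U r (ρ 0) x₀ < 1 := by
    refine lt_of_le_of_lt (ENNReal.tsum_le_tsum fun n => ?_) hlt
    exact indicator_le_self' (fun _ _ => zero_le) _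
  have hstep : ∀ i c, ∃ c', potential C τ U r (ρ i) c < 1 →
      Metric.closedBall c' (ρ (i + 1)) ⊆ Metric.closedBall c (ρ i) ∧
      Metric.closedBall c' (ρ (i + 1)) ⊆ F i ∧ potential C τ U r (ρ (i + 1)) c' < 1 := by
    intro i c
    by_cases h1 : potential C τ U r (ρ i) c < 1
    · obtain ⟨c', h2, h3, h4⟩ := (hchild i c).exists_potential_le hC hτ hτt (hρ i) (hρ _)
        (hsmall i) hr hU
      exact ⟨c', fun _ => ⟨h2, h3, h4.trans_lt h1⟩⟩
    · exact ⟨c, fun h => absurd h h1⟩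
  choose f hf using hstep
  let c : ℕ → X := fun n => Nat.rec x₀ (fun i c => f i c) n
  have hc : ∀ i, potential C τ U r (ρ i) (c i) < 1 := by
    intro i
    induction i with
    | zero => exact hpot0
    | succ i ih => exact (hf i (c i) ih).2.2
  have hanti : Antitone fun i => Metric.closedBall (c i) (ρ i) :=
    antitone_nat_of_succ_le fun i => (hf i (c i) (hc i)).1
  have hmem : ∀ n m, n ≤ m → c m ∈ Metric.closedBall (c n) (ρ n) := fun n m hnm =>
    hanti hnm (Metric.mem_closedBall_self (hρ m).le)
  have hcauchy : CauchySeq c := cauchySeq_of_le_tendsto_0' ρ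
    (fun n m hnm => by rw [dist_comm]; exact hmem n m hnm) hρ0
  obtain ⟨x, hx⟩ := cauchySeq_tendsto_of_complete hcauchy
  have hxmem : ∀ i, x ∈ Metric.closedBall (c i) (ρ i) := fun i =>
    Metric.isClosed_closedBall.mem_of_tendsto hx
      ((eventually_ge_atTop i).mono fun m hm => hmem i m hm)
  obtain ⟨n, hn⟩ := mem_iUnion.1 (hcov ⟨hxmem 0, mem_iInter.2 fun i =>
    (hf i (c i) (hc i)).2.1 (hxmem (i + 1))⟩)
  obtain ⟨i, hi⟩ := (hρ0.eventually (gt_mem_nhds (hr n))).exists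
  refine absurd (hc i) (not_lt.2 ?_)
  refine le_trans ?_ (ENNReal.le_tsum n)
  rw [indicator_of_mem (by exact ⟨x, hxmem i, hn⟩)]
  have h1 : 1 ≤ (r n / ρ i) ^ τ := Real.one_le_rpow ((one_le_div (hρ i)).2 hi.le) hτ.le
  have h2 : weight C τ (ρ i) (r n) = 1 :=
    min_eq_left (by nlinarith)
  rw [h2, ENNReal.ofReal_one]

theorem hausdorffMeasure_ne_zero_of_hasChildren {X ι : Type*} [MetricSpace X] [CompleteSpace X]
    [MeasurableSpace X] [BorelSpace X] {C t τ : ℝ}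
    {ρ : ℕ → ℝ} (hC : 1 ≤ C) (hτ : 0 < τ) (hτt : τ < t) (hρ : ∀ i, 0 < ρ i)
    (hρ0 : Tendsto ρ atTop (𝓝 0)) (hsmall : ∀ i, C * (ρ (i + 1) / ρ i) ^ (t - τ) ≤ 1)
    {F : ℕ → Set X} (hchild : ∀ i c, HasChildren ι C t (ρ i) (ρ (i + 1)) (F i) c) (x₀ : X) :
    μH[τ] (Metric.closedBall x₀ (ρ 0) ∩ ⋂ i, F i) ≠ 0 := by
  intro h0
  rw [hausdorffMeasure_apply] at h0
  set K : ℝ := C * ((ρ 0) ^ τ)⁻¹ with hK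
  have hρτ : 0 < ρ 0 ^ τ := Real.rpow_pos_of_pos (hρ 0) _
  have hKpos : 0 < K := by positivity
  set ε : ℝ≥0∞ := ENNReal.ofReal ((4 * K)⁻¹) with hε
  have hεpos : 0 < ε := ENNReal.ofReal_pos.2 (by positivity)
  have h1 : (⨅ (T : ℕ → Set X) (_ : Metric.closedBall x₀ (ρ 0) ∩ ⋂ i, F i ⊆ ⋃ n, T n)
      (_ : ∀ n, Metric.ediam (T n) ≤ 1), ∑' n, ⨆ _ : (T n).Nonempty, Metric.ediam (T n) ^ τ) < ε := by
    refine lt_of_le_of_lt ?_ hεpos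
    rw [← h0]
    exact le_iSup₂_of_le (1 : ℝ≥0∞) one_pos le_rfl
  simp only [iInf_lt_iff] at h1
  obtain ⟨T, hT, hT1, hTsum⟩ := h1
  -- Covering sets may have diameter 0, while the weights need r > 0. Adding summable δ n to the
  -- τ-th powers of the diameters fixes this. The total is then at most K(ε + ε) = 1/2.
  obtain ⟨δ, hδ, hδsum⟩ := ENNReal.exists_pos_sum_of_countable hεpos.ne' ℕ
  have hTfin : ∀ n, Metric.ediam (T n) ≠ ∞ := fun n => ne_top_of_le_ne_top ENNReal.one_ne_top (hT1 n)
  set v : ℕ → ℝ := fun n => (Metric.ediam (T n)).toReal ^ τ + δ n with hv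
  have hvpos : ∀ n, 0 < v n := fun n =>
    add_pos_of_nonneg_of_pos (by positivity) (by exact_mod_cast hδ n)
  have hr : ∀ n, 0 < v n ^ τ⁻¹ := fun n => Real.rpow_pos_of_pos (hvpos n) _
  have hdiam : ∀ n, ∀ a ∈ T n, ∀ b ∈ T n, dist a b ≤ v n ^ τ⁻¹ := by
    intro n a ha b hb
    have h2 : dist a b ≤ (Metric.ediam (T n)).toReal := by
      rw [dist_edist]
      exact ENNReal.toReal_mono (hTfin n) (Metric.edist_le_ediam_of_mem ha hb)
    rw [Real.le_rpow_inv_iff_of_pos dist_nonneg (hvpos n).le hτ]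
    refine (Real.rpow_le_rpow dist_nonneg h2 hτ.le).trans ?_
    simp [hv]
  have hmain := one_le_tsum_weight hC hτ hτt hρ hρ0 hsmall hchild x₀ hr hdiam hT
  refine absurd hmain (not_le.2 ?_)
  have hterm : ∀ n, ENNReal.ofReal (weight C τ (ρ 0) (v n ^ τ⁻¹)) ≤
      ENNReal.ofReal K * ((⨆ _ : (T n).Nonempty, Metric.ediam (T n) ^ τ) + δ n) := by
    intro n
    have h3 : weight C τ (ρ 0) (v n ^ τ⁻¹) ≤ K * v n := by
      refine (min_le_right _ _).trans (le_of_eq ?_)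
      rw [Real.div_rpow (hr n).le (hρ 0).le, Real.rpow_inv_rpow (hvpos n).le hτ.ne', hK]
      ring
    refine (ENNReal.ofReal_le_ofReal h3).trans ?_
    rw [ENNReal.ofReal_mul hKpos.le, hv, ENNReal.ofReal_add (by positivity) (by positivity),
      ENNReal.ofReal_coe_nnreal, ← ENNReal.ofReal_rpow_of_nonneg (by positivity) hτ.le,
      ENNReal.ofReal_toReal (hTfin n)]
    gcongr
    rcases (T n).eq_empty_or_nonempty with he | hne
    · simp [he, hτ]
    · exact le_iSup_of_le hne le_rfl
  calc ∑' n, ENNReal.ofReal (weight C τ (ρ 0) (v n ^ τ⁻¹))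
      ≤ ∑' n, ENNReal.ofReal K * ((⨆ _ : (T n).Nonempty, Metric.ediam (T n) ^ τ) + δ n) :=
        ENNReal.tsum_le_tsum hterm
    _ = ENNReal.ofReal K * ((∑' n, ⨆ _ : (T n).Nonempty, Metric.ediam (T n) ^ τ) + ∑' n, (δ n : ℝ≥0∞)) := by
        rw [ENNReal.tsum_mul_left, ENNReal.tsum_add]
    _ ≤ ENNReal.ofReal K * (ε + ε) := by gcongr
    _ = ENNReal.ofReal (1 / 2) := by
        rw [hε, ← ENNReal.ofReal_add (by positivity) (by positivity),
          ← ENNReal.ofReal_mul hKpos.le]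
        congr 1
        field_simp
        norm_num
    _ < 1 := by
        rw [← ENNReal.ofReal_one]
        exact (ENNReal.ofReal_lt_ofReal_iff one_pos).2 (by norm_num)

/-! ### Prime denominators -/

theorem eventually_rpow_le_primeCounting {θ : ℝ} (hθ : θ < 1) :
    ∀ᶠ x : ℝ in atTop, 2 * x ^ θ ≤ Nat.primeCounting ⌊x⌋₊ := by
  have h1 := (isLittleO_log_rpow_atTop (sub_pos.2 hθ)).bound (show (0 : ℝ) < 1 / 16 by norm_num)
  have h2 := (isLittleO_log_rpow_atTop one_pos).bound (show (0 : ℝ) < 1 / 16 by norm_num)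
  filter_upwards [h1, h2, eventually_ge_atTop 4] with x h1 h2 hx
  have hx0 : 0 < x := by linarith
  have hlog : 0 < Real.log x := Real.log_pos (by linarith)
  rw [Real.norm_of_nonneg hlog.le, Real.norm_of_nonneg (by positivity)] at h1 h2
  rw [Real.rpow_one] at h2
  refine le_trans ?_ (Chebyshev.pi_ge' (by linarith))
  rw [le_div_iff₀ hlog]
  have h3 : Real.log (x + 2) ≤ 2 * Real.log x := by
    rw [← Real.log_rpow hx0]
    refine Real.log_le_log (by linarith) ?_
    rw [Real.rpow_two]
    nlinarith
  have h4 : x ^ θ * Real.log x ≤ x / 16 := by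
    calc x ^ θ * Real.log x ≤ x ^ θ * (1 / 16 * x ^ (1 - θ)) := by gcongr
      _ = x ^ θ * x ^ (1 - θ) / 16 := by ring
      _ = x / 16 := by rw [← Real.rpow_add hx0]; simp
  nlinarith [Real.log_two_gt_d9]

/-- The denominators used in the construction: they are pairwise coprime, lie between `q ^ γ'` and
`q ^ γ`, and there are at least `q ^ γ'` of them. -/
structure IsDenominatorSet (γ γ' q : ℝ) (𝓗 : Finset ℕ) : Prop where
  one_or_prime : ∀ H ∈ 𝓗, H = 1 ∨ H.Prime
  le_rpow : ∀ H ∈ 𝓗, (H : ℝ) ≤ q ^ γ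
  rpow_le : ∀ H ∈ 𝓗, q ^ γ' ≤ H
  rpow_le_card : q ^ γ' ≤ 𝓗.card

theorem isDenominatorSet_zero (q : ℝ) : IsDenominatorSet 0 0 q {1} := by
  constructor <;> simp

/-- Up to q^γ there are at least 2q^γ' primes, by Chebyshev's bound with θ = γ'/γ; at most q^γ' of
them lie below q^γ'. -/
theorem eventually_exists_isDenominatorSet {γ γ' : ℝ} (hγ' : 0 < γ') (h : γ' < γ) :
    ∀ᶠ q : ℝ in atTop, ∃ 𝓗, IsDenominatorSet γ γ' q 𝓗 := by
  have hγ : 0 < γ := hγ'.trans h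
  have h1 := (tendsto_rpow_atTop hγ).eventually
    (eventually_rpow_le_primeCounting ((div_lt_one hγ).2 h))
  filter_upwards [h1, eventually_gt_atTop 0] with q hq hq0
  rw [← Real.rpow_mul hq0.le, mul_div_cancel₀ _ hγ.ne'] at hq
  refine ⟨(Nat.primesLE ⌊q ^ γ⌋₊).filter fun p => q ^ γ' ≤ p, ?_, ?_, ?_, ?_⟩
  · intro H hH
    exact Or.inr (Nat.mem_primesLE.1 (Finset.mem_filter.1 hH).1).2
  · intro H hH
    exact (Nat.le_floor_iff (by positivity)).1 (Nat.mem_primesLE.1 (Finset.mem_filter.1 hH).1).1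
  · exact fun H hH => (Finset.mem_filter.1 hH).2
  · have h2 := Finset.card_filter_add_card_filter_not (s := Nat.primesLE ⌊q ^ γ⌋₊)
      (fun p : ℕ => q ^ γ' ≤ p)
    have h3 : ((Nat.primesLE ⌊q ^ γ⌋₊).filter fun p : ℕ => ¬ q ^ γ' ≤ p) ⊆
        Finset.Icc 1 ⌊q ^ γ'⌋₊ := by
      intro p hp
      obtain ⟨hp1, hp2⟩ := Finset.mem_filter.1 hp
      exact Finset.mem_Icc.2 ⟨(Nat.mem_primesLE.1 hp1).2.one_le, Nat.le_floor (not_le.1 hp2).le⟩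
    have h4 := Finset.card_le_card h3
    rw [Nat.card_Icc, Nat.add_sub_cancel] at h4
    have h5 : (⌊q ^ γ'⌋₊ : ℝ) ≤ q ^ γ' := Nat.floor_le (by positivity)
    rw [Nat.primesLE_card_eq_primeCounting] at h2
    have h6 : ((Nat.primeCounting ⌊q ^ γ⌋₊ : ℕ) : ℝ) ≤
        ((Nat.primesLE ⌊q ^ γ⌋₊).filter fun p : ℕ => q ^ γ' ≤ p).card + ⌊q ^ γ'⌋₊ := by
      exact_mod_cast h2 ▸ Nat.add_le_add_left h4 _
    linarith

/-! ### Counting numerators and close pairs in one coordinate -/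

theorem card_le_of_separated {α : Type*} (S : Finset α) (f : α → ℝ) {a b δ : ℝ} (hδ : 0 < δ)
    (hab : a ≤ b) (hf : ∀ x ∈ S, f x ∈ Icc a b)
    (hsep : ∀ x ∈ S, ∀ y ∈ S, x ≠ y → δ ≤ |f x - f y|) : (S.card : ℝ) ≤ (b - a) / δ + 1 := by
  have hb : 0 ≤ (b - a) / δ := div_nonneg (by linarith) hδ.le
  have h1 : S.card ≤ (Finset.Icc 0 ⌊(b - a) / δ⌋).card := by
    refine Finset.card_le_card_of_injOn (fun x => ⌊(f x - a) / δ⌋) ?_ ?_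
    · intro x hx
      obtain ⟨h1, h2⟩ := hf x hx
      refine Finset.mem_coe.2 (Finset.mem_Icc.2 ⟨Int.floor_nonneg.2 (div_nonneg (by linarith) hδ.le),
        Int.floor_le_floor ?_⟩)
      gcongr
    · intro x hx y hy hxy
      by_contra hne
      have h2 := Int.abs_sub_lt_one_of_floor_eq_floor hxy
      rw [← sub_div, abs_div, abs_of_pos hδ, div_lt_one hδ, sub_sub_sub_cancel_right] at h2
      exact absurd (hsep x hx y hy hne) (not_le.2 h2)
  rw [Int.card_Icc, sub_zero] at h1
  have h3 : (((⌊(b - a) / δ⌋ + 1).toNat : ℤ) : ℝ) = ⌊(b - a) / δ⌋ + 1 := by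
    rw [Int.toNat_of_nonneg (by have := Int.floor_nonneg.2 hb; omega)]
    push_cast; ring
  rw [Int.cast_natCast] at h3
  have h4 : (S.card : ℝ) ≤ ((⌊(b - a) / δ⌋ + 1).toNat : ℝ) := by exact_mod_cast h1
  rw [h3] at h4
  linarith [Int.floor_le ((b - a) / δ)]

open Classical in
/-- The numerators `p` coprime to `H` for which `p / (H w)` is within `ℓ / 2` of `c`. -/
noncomputable def numerators (w c ℓ : ℝ) (H : ℕ) : Finset ℤ :=
  (Finset.Icc ⌈(H * w) * (c - ℓ / 2)⌉ ⌊(H * w) * (c + ℓ / 2)⌋).filter fun p => IsCoprime p (H : ℤ)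

theorem mem_numerators {w c ℓ : ℝ} {H : ℕ} (hw : 0 < w) (hH : 0 < H) {p : ℤ} :
    p ∈ numerators w c ℓ H ↔ |(p : ℝ) / (H * w) - c| ≤ ℓ / 2 ∧ IsCoprime p (H : ℤ) := by
  have hH' : (0 : ℝ) < H := by exact_mod_cast hH
  have hD : 0 < (H : ℝ) * w := by positivity
  rw [numerators, Finset.mem_filter, Finset.mem_Icc, Int.ceil_le, Int.le_floor, abs_le,
    ← le_div_iff₀' hD, ← div_le_iff₀' hD]
  constructor
  · rintro ⟨⟨h1, h2⟩, h3⟩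
    exact ⟨⟨by linarith, by linarith⟩, h3⟩
  · rintro ⟨⟨h1, h2⟩, h3⟩
    exact ⟨⟨by linarith, by linarith⟩, h3⟩

theorem card_int_near_le {D : ℝ} (hD : 0 < D) {x r : ℝ} (hr : 0 ≤ r) (S : Finset ℤ)
    (hS : ∀ p ∈ S, |(p : ℝ) / D - x| ≤ r) : (S.card : ℝ) ≤ 2 * r * D + 1 := by
  have := card_le_of_separated S (fun p : ℤ => (p : ℝ) / D) (a := x - r) (b := x + r)
    (δ := 1 / D) (by positivity) (by linarith) (fun p hp => by
      have := abs_le.1 (hS p hp)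
      exact ⟨by linarith, by linarith⟩) (fun p _ p' _ hne => by
      rw [← sub_div, abs_div, abs_of_pos hD]
      gcongr
      have : 1 ≤ |p - p'| := Int.one_le_abs (sub_ne_zero.2 hne)
      exact_mod_cast this)
  refine this.trans (le_of_eq ?_)
  field_simp
  ring

theorem card_numerators_le {w c ℓ : ℝ} {H : ℕ} (hw : 0 < w) (hH : 0 < H) (hℓ : 0 ≤ ℓ) :
    ((numerators w c ℓ H).card : ℝ) ≤ H * w * ℓ + 1 := by
  have hH' : (0 : ℝ) < H := by exact_mod_cast hH
  refine (card_int_near_le (D := H * w) (by positivity) (x := c) (r := ℓ / 2) (by linarith) _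
    fun p hp => ((mem_numerators hw hH).1 hp).1).trans (le_of_eq (by ring))

theorem isCoprime_or_isCoprime_add_one {H : ℕ} (hH : H = 1 ∨ H.Prime) (k : ℤ) :
    IsCoprime k (H : ℤ) ∨ IsCoprime (k + 1) (H : ℤ) := by
  rcases hH with rfl | hH
  · left; simp [isCoprime_one_right]
  · by_contra! h
    have hp : Prime (H : ℤ) := Nat.prime_iff_prime_int.1 hH
    have h1 : ∀ m : ℤ, ¬ IsCoprime m (H : ℤ) → (H : ℤ) ∣ m := fun m hm => by
      by_contra hdvd
      exact hm ((hp.irreducible.coprime_iff_not_dvd.2 hdvd).symm)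
    have h2 := (dvd_sub (h1 _ h.2) (h1 _ h.1))
    rw [add_sub_cancel_left] at h2
    exact hp.not_isUnit (isUnit_of_dvd_one h2)

/-- Each pair 2k, 2k + 1 contains an integer coprime to H. Rounding leaves at least Hwℓ/2 - 3/2 such
pairs, which is at least Hwℓ/4 exactly when Hwℓ ≥ 6. -/
theorem le_card_numerators {w c ℓ : ℝ} {H : ℕ} (hw : 0 < w) (hH : H = 1 ∨ H.Prime)
    (hℓ : 6 ≤ H * w * ℓ) : (H : ℝ) * w * ℓ / 4 ≤ (numerators w c ℓ H).card := by
  classical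
  have hH0 : 0 < H := by rcases hH with rfl | hH; exacts [one_pos, hH.pos]
  have hH' : (0 : ℝ) < H := by exact_mod_cast hH0
  have hD : 0 < (H : ℝ) * w := by positivity
  set a := ⌈(H : ℝ) * w * (c - ℓ / 2) / 2⌉ with ha
  set b := ⌊((H : ℝ) * w * (c + ℓ / 2) - 1) / 2⌋ with hb
  have hcard : (Finset.Icc a b).card ≤ (numerators w c ℓ H).card := by
    refine Finset.card_le_card_of_injOn
      (fun k => if IsCoprime (2 * k) (H : ℤ) then 2 * k else 2 * k + 1) ?_ ?_
    · intro k hk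
      obtain ⟨h1, h2⟩ := Finset.mem_Icc.1 (Finset.mem_coe.1 hk)
      rw [ha, Int.ceil_le] at h1
      rw [hb, Int.le_floor] at h2
      rw [Finset.mem_coe, numerators, Finset.mem_filter, Finset.mem_Icc, Int.ceil_le, Int.le_floor]
      dsimp only
      split_ifs with hc
      · refine ⟨⟨?_, ?_⟩, hc⟩ <;> push_cast <;> linarith
      · refine ⟨⟨?_, ?_⟩, (isCoprime_or_isCoprime_add_one hH _).resolve_left hc⟩ <;>
          push_cast <;> linarith
    · intro k _ k' _ hkk
      dsimp only at hkk
      split_ifs at hkk <;> omega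
  have h1 : (b : ℝ) + 1 - a ≤ (Finset.Icc a b).card := by
    rw [Int.card_Icc]
    exact_mod_cast Int.self_le_toNat (b + 1 - a)
  have h2 : ((Finset.Icc a b).card : ℝ) ≤ (numerators w c ℓ H).card := by exact_mod_cast hcard
  have h3 := Int.ceil_lt_add_one ((H : ℝ) * w * (c - ℓ / 2) / 2)
  have h4 := Int.sub_one_lt_floor (((H : ℝ) * w * (c + ℓ / 2) - 1) / 2)
  rw [← ha] at h3
  rw [← hb] at h4
  nlinarith

open Classical in
/-- The pairs of numerators for the denominators `H` and `H'` whose fractions are `r`-close. -/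
noncomputable def closePairs (w c ℓ r : ℝ) (H H' : ℕ) : Finset (ℤ × ℤ) :=
  (numerators w c ℓ H ×ˢ numerators w c ℓ H').filter fun p =>
    |(p.1 : ℝ) / (H * w) - p.2 / (H' * w)| ≤ r

theorem card_closePairs_le {w c ℓ r : ℝ} {H H' : ℕ} (hw : 0 < w) (hH : 0 < H) (hH' : 0 < H')
    (hℓ : 0 ≤ ℓ) (hr : 0 ≤ r) :
    ((closePairs w c ℓ r H H').card : ℝ) ≤ (H * w * ℓ + 1) * (2 * r * (H' * w) + 1) := by
  classical
  have h1 : (closePairs w c ℓ r H H').card = ∑ p ∈ numerators w c ℓ H,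
      ((numerators w c ℓ H').filter fun p' : ℤ => |(p : ℝ) / (H * w) - p' / (H' * w)| ≤ r).card := by
    simp only [closePairs, Finset.card_filter, Finset.sum_product]
  have hH0 : (0 : ℝ) < H' := by exact_mod_cast hH'
  rw [h1]
  push_cast
  refine (Finset.sum_le_card_nsmul _ _ (2 * r * (H' * w) + 1) fun p _ => ?_).trans ?_
  · refine card_int_near_le (x := (p : ℝ) / (H * w)) (by positivity) hr _ fun p' hp' => ?_
    rw [abs_sub_comm]
    exact (Finset.mem_filter.1 hp').2
  · rw [nsmul_eq_mul]
    gcongr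
    exact card_numerators_le hw hH hℓ

theorem card_nonzero_int_le {M : ℝ} (hM : 0 ≤ M) :
    (((Finset.Icc (-⌊M⌋) ⌊M⌋).erase 0).card : ℝ) ≤ 2 * M := by
  have h0 := Int.floor_nonneg.2 hM
  rw [Finset.card_erase_of_mem (Finset.mem_Icc.2 ⟨by omega, h0⟩), Int.card_Icc]
  have h1 : (((⌊M⌋ + 1 - -⌊M⌋).toNat - 1 : ℕ) : ℤ) = 2 * ⌊M⌋ := by omega
  have h2 : (((⌊M⌋ + 1 - -⌊M⌋).toNat - 1 : ℕ) : ℝ) = 2 * ⌊M⌋ := by exact_mod_cast h1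
  rw [h2]
  linarith [Int.floor_le M]

/-- For a close pair, m = pH' - p'H satisfies |m| ≤ rHH'w, and m ≠ 0 because both fractions are
reduced with different denominators. Given m, the numerator p is fixed modulo H, so the values
p/(Hw) are 1/w-separated. There is no additive error in the first factor: if rHH'w < 1 there are no
close pairs at all. -/
theorem card_closePairs_le_of_coprime {w c ℓ r : ℝ} {H H' : ℕ} (hw : 0 < w) (hH : 0 < H)
    (hH' : 0 < H') (hne : H ≠ H') (hcop : IsCoprime (H : ℤ) (H' : ℤ)) (hℓ : 0 ≤ ℓ) (hr : 0 ≤ r) :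
    ((closePairs w c ℓ r H H').card : ℝ) ≤ 2 * (r * H * H' * w) * (w * ℓ + 1) := by
  classical
  have hHr : (0 : ℝ) < H := by exact_mod_cast hH
  have hHr' : (0 : ℝ) < H' := by exact_mod_cast hH'
  set M : ℝ := r * H * H' * w with hM
  have hM0 : 0 ≤ M := by positivity
  have hmaps : Set.MapsTo (fun p : ℤ × ℤ => p.1 * H' - p.2 * H) (closePairs w c ℓ r H H')
      ((Finset.Icc (-⌊M⌋) ⌊M⌋).erase 0) := by
    rintro ⟨p, p'⟩ hp
    obtain ⟨h1, h2⟩ := Finset.mem_filter.1 (Finset.mem_coe.1 hp)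
    obtain ⟨h3, h4⟩ := Finset.mem_product.1 h1
    have hp := ((mem_numerators hw hH).1 h3).2
    have hp' := ((mem_numerators hw hH').1 h4).2
    dsimp only at hp hp' h2 ⊢
    refine Finset.mem_coe.2 (Finset.mem_erase.2 ⟨fun h0 => hne ?_, ?_⟩)
    · have h5 : p * H' = p' * H := by linarith
      have h6 : (H : ℤ) ∣ H' := hp.symm.dvd_of_dvd_mul_left (h5 ▸ Dvd.intro_left _ rfl)
      have h7 : (H' : ℤ) ∣ H := hp'.symm.dvd_of_dvd_mul_left (h5 ▸ Dvd.intro_left _ rfl)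
      exact Nat.dvd_antisymm (Int.natCast_dvd_natCast.1 h6) (Int.natCast_dvd_natCast.1 h7)
    · have h5 : |((p * H' - p' * H : ℤ) : ℝ)| ≤ M := by
        have h6 : ((p * H' - p' * H : ℤ) : ℝ) =
            ((p : ℝ) / (H * w) - p' / (H' * w)) * (H * H' * w) := by
          push_cast; field_simp
        rw [h6, abs_mul, abs_of_pos (show (0 : ℝ) < H * H' * w by positivity), hM]
        calc _ ≤ r * (H * H' * w) := by gcongr
          _ = _ := by ring
      obtain ⟨h7, h8⟩ := abs_le.1 h5
      refine Finset.mem_Icc.2 ⟨?_, Int.le_floor.2 h8⟩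
      rw [neg_le, Int.le_floor]
      push_cast at h7 ⊢
      linarith
  rw [Finset.card_eq_sum_card_fiberwise hmaps]
  push_cast
  have hfib : ∀ m ∈ (Finset.Icc (-⌊M⌋) ⌊M⌋).erase 0,
      (((closePairs w c ℓ r H H').filter fun p : ℤ × ℤ => p.1 * H' - p.2 * H = m).card : ℝ) ≤
        w * ℓ + 1 := by
    intro m _
    have hmem : ∀ p ∈ (closePairs w c ℓ r H H').filter fun p : ℤ × ℤ => p.1 * H' - p.2 * H = m,
        |(p.1 : ℝ) / (H * w) - c| ≤ ℓ / 2 ∧ p.1 * H' - p.2 * H = m := by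
      intro p hp
      obtain ⟨h1, h2⟩ := Finset.mem_filter.1 hp
      exact ⟨((mem_numerators hw hH).1
        (Finset.mem_product.1 (Finset.mem_filter.1 h1).1).1).1, h2⟩
    refine (card_le_of_separated _ (fun p : ℤ × ℤ => (p.1 : ℝ) / (H * w))
      (a := c - ℓ / 2) (b := c + ℓ / 2) (δ := 1 / w) (by positivity) (by linarith)
      (fun p hp => ?_) fun p hp p' hp' hpp => ?_).trans (le_of_eq ?_)
    · have := abs_le.1 (hmem p hp).1
      exact ⟨by linarith, by linarith⟩
    · have h1 := (hmem p hp).2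
      have h2 := (hmem p' hp').2
      have h3 : (p.1 - p'.1) * H' = (p.2 - p'.2) * H := by linarith
      have h4 : (H : ℤ) ∣ p.1 - p'.1 :=
        hcop.dvd_of_dvd_mul_right (h3 ▸ Dvd.intro_left _ rfl)
      have h5 : p.1 - p'.1 ≠ 0 := by
        intro h0
        rw [h0, zero_mul, eq_comm, mul_eq_zero] at h3
        have h6 := h3.resolve_right (by exact_mod_cast hH.ne')
        exact hpp (Prod.ext (by linarith) (by linarith))
      have h6 : (H : ℤ) ≤ |p.1 - p'.1| := by
        have := Int.le_of_dvd (abs_pos.2 h5) ((dvd_abs _ _).2 h4)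
        exact this
      have h7 : (H : ℝ) ≤ |(p.1 : ℝ) - p'.1| := by exact_mod_cast h6
      rw [← sub_div, abs_div, abs_of_pos (show 0 < (H : ℝ) * w by positivity),
        div_le_div_iff₀ hw (by positivity)]
      nlinarith
    · field_simp
      ring
  refine (Finset.sum_le_card_nsmul _ _ _ hfib).trans ?_
  rw [nsmul_eq_mul]
  gcongr
  exact card_nonzero_int_le hM0

/-! ### Counting close pairs in the cube -/

/-- Denominators in `𝓗` with admissible numerators, for the cube of side `ℓ` about `c`. -/
noncomputable def fractions {d : ℕ} (w c : Fin d → ℝ) (ℓ : ℝ) (𝓗 : Finset ℕ) :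
    Finset (Σ _ : ℕ, Fin d → ℤ) :=
  𝓗.sigma fun H => Fintype.piFinset fun j => numerators (w j) (c j) ℓ H

/-- The point `(p_j / (H w_j))_j`. -/
noncomputable def fracPoint {d : ℕ} (w : Fin d → ℝ) (a : Σ _ : ℕ, Fin d → ℤ) : Fin d → ℝ :=
  fun j => a.2 j / (a.1 * w j)

-- In the maximum norm two points are close iff all coordinates are, so for fixed H, H' the count is
-- bounded by a product over coordinates.
open Classical in
theorem sum_card_close_le {d : ℕ} (w c : Fin d → ℝ) (ℓ : ℝ) (𝓗 : Finset ℕ) {r : ℝ} (hr : 0 ≤ r) :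
    ∑ a ∈ fractions w c ℓ 𝓗,
        ((fractions w c ℓ 𝓗).filter fun b => dist (fracPoint w a) (fracPoint w b) ≤ r).card ≤
      ∑ H ∈ 𝓗, ∑ H' ∈ 𝓗, ∏ j, (closePairs (w j) (c j) ℓ r H H').card := by
  simp only [fractions, Finset.card_filter, Finset.sum_sigma]
  refine Finset.sum_le_sum fun H _ => ?_
  rw [Finset.sum_comm]
  refine Finset.sum_le_sum fun H' _ => ?_
  rw [← Finset.sum_product', ← Finset.card_filter, ← Fintype.card_piFinset]
  refine Finset.card_le_card_of_injOn (fun p j => (p.1 j, p.2 j)) ?_ ?_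
  · rintro ⟨p, p'⟩ hp
    obtain ⟨h1, h2⟩ := Finset.mem_filter.1 (Finset.mem_coe.1 hp)
    obtain ⟨h3, h4⟩ := Finset.mem_product.1 h1
    rw [Fintype.mem_piFinset] at h3 h4
    rw [dist_pi_le_iff hr] at h2
    refine Finset.mem_coe.2 (Fintype.mem_piFinset.2 fun j => Finset.mem_filter.2
      ⟨Finset.mem_product.2 ⟨h3 j, h4 j⟩, ?_⟩)
    have := h2 j
    rwa [Real.dist_eq] at this
  · rintro ⟨p, p'⟩ _ ⟨u, u'⟩ _ h
    have h' : ∀ j, (p j, p' j) = (u j, u' j) := fun j => congrFun h j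
    simp only [Prod.mk.injEq] at h' ⊢
    exact ⟨funext fun j => (h' j).1, funext fun j => (h' j).2⟩

/-- The expected number of admissible numerators for the denominator `H`. -/
noncomputable def mass {d : ℕ} (w : Fin d → ℝ) (ℓ : ℝ) (H : ℕ) : ℝ := ∏ j, (H * w j * ℓ)

theorem sum_mass_le_card {d : ℕ} {w c : Fin d → ℝ} {ℓ : ℝ} {𝓗 : Finset ℕ}
    (hw : ∀ j, 0 < w j) (h𝓗 : ∀ H ∈ 𝓗, H = 1 ∨ H.Prime) (hℓ0 : 0 ≤ ℓ)
    (hℓ : ∀ H ∈ 𝓗, ∀ j, 6 ≤ H * w j * ℓ) :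
    ∑ H ∈ 𝓗, mass w ℓ H ≤ 4 ^ d * (fractions w c ℓ 𝓗).card := by
  rw [fractions, Finset.card_sigma]
  push_cast
  rw [Finset.mul_sum]
  refine Finset.sum_le_sum fun H hH => ?_
  have h4 : (4 : ℝ) ^ d = ∏ _j : Fin d, 4 := by simp
  rw [Fintype.card_piFinset, mass, h4]
  push_cast
  rw [← Finset.prod_mul_distrib]
  refine Finset.prod_le_prod (fun j _ => by have := hw j; positivity) fun j _ => ?_
  have := le_card_numerators (c := c j) (hw j) (h𝓗 H hH) (hℓ H hH j)
  linarith

theorem prod_card_closePairs_le_of_large {d : ℕ} {w c : Fin d → ℝ} {ℓ r : ℝ} {H H' : ℕ}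
    (hw : ∀ j, 0 < w j) (hH : 0 < H) (hH' : 0 < H') (hℓ0 : 0 < ℓ) (hr : 0 ≤ r)
    (hℓ : ∀ j, 1 ≤ H * w j * ℓ) (hr' : ∀ j, 1 ≤ r * (H' * w j)) :
    ∏ j, ((closePairs (w j) (c j) ℓ r H H').card : ℝ) ≤
      6 ^ d * (r / ℓ) ^ d * (mass w ℓ H * mass w ℓ H') := by
  have h6 : ∀ x : ℝ, x ^ d = ∏ _j : Fin d, x := by simp
  rw [mass, mass, ← mul_pow, h6, ← Finset.prod_mul_distrib, ← Finset.prod_mul_distrib]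
  refine Finset.prod_le_prod (fun j _ => by positivity) fun j _ => ?_
  have h1 := card_closePairs_le (c := c j) (hw j) hH hH' hℓ0.le hr
  have h2 : (0 : ℝ) ≤ H * w j * ℓ + 1 := by linarith [hℓ j]
  calc _ ≤ _ := h1
    _ ≤ (2 * (H * w j * ℓ)) * (3 * (r * (H' * w j))) :=
        mul_le_mul (by linarith [hℓ j]) (by linarith [hr' j]) (by linarith [hr' j])
          (by linarith [hℓ j])
    _ = _ := by field_simp; ring

theorem prod_card_closePairs_le_of_coprime {d : ℕ} {w c : Fin d → ℝ} {ℓ r : ℝ} {H H' : ℕ}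
    (hw : ∀ j, 1 ≤ w j) (hH : 0 < H) (hH' : 0 < H') (hne : H ≠ H')
    (hcop : IsCoprime (H : ℤ) (H' : ℤ)) (hℓ0 : 0 < ℓ) (hℓ1 : ℓ ≤ 1) (hr : 0 ≤ r) :
    ∏ j, ((closePairs (w j) (c j) ℓ r H H').card : ℝ) ≤
      4 ^ d * ((r / ℓ) ^ d * (ℓ ^ d)⁻¹) * (mass w ℓ H * mass w ℓ H') := by
  have h6 : ∀ x : ℝ, x ^ d = ∏ _j : Fin d, x := by simp
  rw [mass, mass, ← inv_pow, ← mul_pow, ← mul_pow, h6, ← Finset.prod_mul_distrib,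
    ← Finset.prod_mul_distrib]
  refine Finset.prod_le_prod (fun j _ => by positivity) fun j _ => ?_
  have hw0 : 0 < w j := by linarith [hw j]
  have h1 := card_closePairs_le_of_coprime (c := c j) hw0 hH hH' hne hcop hℓ0.le hr
  calc _ ≤ _ := h1
    _ ≤ 2 * (r * H * H' * w j) * (2 * w j) := by
        gcongr
        nlinarith [hw j]
    _ = _ := by field_simp; ring

theorem prod_card_closePairs_self_le {d : ℕ} {w c a : Fin d → ℝ} {ℓ r q : ℝ} {H : ℕ}
    (hw : ∀ j, 0 < w j) (hH : 0 < H) (hℓ0 : 0 < ℓ) (hr : 0 ≤ r)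
    (hℓ : ∀ j, 1 ≤ H * w j * ℓ) (hrq : 1 ≤ r * q) (hr1 : r ≤ 1) (ha : ∀ j, 0 ≤ a j ∧ a j ≤ 1)
    (hD : ∀ j, H * w j ≤ q ^ a j) :
    ∏ j, ((closePairs (w j) (c j) ℓ r H H).card : ℝ) ≤
      6 ^ d * (r * q) ^ (∑ j, a j) * mass w ℓ H := by
  have h6 : ∀ x : ℝ, x ^ d = ∏ _j : Fin d, x := by simp
  have hr0 : 0 < r := lt_of_le_of_ne hr (by rintro rfl; linarith)
  have hq0 : 0 < q := by by_contra! h; nlinarith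
  rw [mass, Real.rpow_sum_of_pos (by linarith), h6, ← Finset.prod_mul_distrib,
    ← Finset.prod_mul_distrib]
  refine Finset.prod_le_prod (fun j _ => by positivity) fun j _ => ?_
  have h1 := card_closePairs_le (c := c j) (hw j) hH hH hℓ0.le hr
  have h2 : 1 ≤ (r * q) ^ a j := Real.one_le_rpow hrq (ha j).1
  -- This uses a j ≤ 1: since r ≤ 1, r is at most r^(a j).
  have h3 : r * (H * w j) ≤ (r * q) ^ a j := by
    rw [Real.mul_rpow hr hq0.le]
    refine mul_le_mul ?_ (hD j) (by have := hw j; positivity) (by positivity)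
    calc r = r ^ (1 : ℝ) := (Real.rpow_one r).symm
      _ ≤ r ^ a j := Real.rpow_le_rpow_of_exponent_ge hr0 hr1 (ha j).2
  calc _ ≤ _ := h1
    _ ≤ (2 * (H * w j * ℓ)) * (3 * (r * q) ^ a j) :=
        mul_le_mul (by linarith [hℓ j]) (by linarith) (by have := hw j; positivity)
          (by linarith [hℓ j])
    _ = _ := by ring

/-- Distinct denominators lose a factor ℓ^(-d) ≤ q^(ηd); the spare power (r/ℓ)^(d-t) ≤
q^(-(κ-η)(d-t)) absorbs it. -/
theorem div_pow_mul_inv_pow_le {d : ℕ} {t κ η q ℓ r : ℝ} (hq : 1 ≤ q) (htd : t ≤ d)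
    (hparam : η * d ≤ (κ - η) * (d - t)) (hℓ0 : 0 < ℓ) (hℓ : q ^ (-η) ≤ ℓ) (hr0 : 0 < r)
    (hr : r ≤ q ^ (-κ)) : (r / ℓ) ^ d * (ℓ ^ d)⁻¹ ≤ (r / ℓ) ^ t := by
  have hq0 : 0 < q := by linarith
  have h1 : r / ℓ ≤ q ^ (η - κ) := by
    rw [div_le_iff₀ hℓ0]
    calc r ≤ q ^ (-κ) := hr
      _ = q ^ (η - κ) * q ^ (-η) := by rw [← Real.rpow_add hq0]; ring_nf
      _ ≤ _ := by gcongr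
  have h2 : (r / ℓ) ^ ((d : ℝ) - t) ≤ q ^ ((η - κ) * (d - t)) := by
    rw [Real.rpow_mul hq0.le]
    exact Real.rpow_le_rpow (by positivity) h1 (by linarith)
  have h3 : (ℓ ^ d)⁻¹ ≤ q ^ (η * d) := by
    rw [Real.rpow_mul hq0.le, Real.rpow_natCast, ← inv_pow]
    gcongr
    rw [inv_le_comm₀ hℓ0 (by positivity), ← Real.rpow_neg hq0.le]
    exact hℓ
  calc (r / ℓ) ^ d * (ℓ ^ d)⁻¹ = (r / ℓ) ^ t * ((r / ℓ) ^ ((d : ℝ) - t) * (ℓ ^ d)⁻¹) := by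
        rw [← mul_assoc, ← Real.rpow_add (by positivity), add_sub_cancel, Real.rpow_natCast]
    _ ≤ (r / ℓ) ^ t * (q ^ ((η - κ) * (d - t)) * q ^ (η * d)) := by gcongr
    _ ≤ (r / ℓ) ^ t * 1 := by
        gcongr
        rw [← Real.rpow_add hq0]
        exact Real.rpow_le_one_of_one_le_of_nonpos hq (by linarith)
    _ = _ := mul_one _

/-- Used for equal denominators: it bounds the loss (rq)^σ by the total mass, of order at least q^s
ℓ^d, times (r/ℓ)^t. The hypotheses on the exponents say that (rq)^(σ-t) ≤ q^(s-t-ηd) for 1 ≤ rq ≤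
q^(1-κ). -/
theorem mul_rpow_le_of_small {d : ℕ} {t κ η q ℓ r σ s : ℝ} (hq : 1 ≤ q) (ht : 0 ≤ t)
    (hparam : (1 - κ) * (σ - t) ≤ s - t - η * d) (hparam' : 0 ≤ s - t - η * d)
    (hℓ0 : 0 < ℓ) (hℓ1 : ℓ ≤ 1) (hℓ : q ^ (-η) ≤ ℓ) (hrq : 1 ≤ r * q) (hr0 : 0 < r)
    (hr : r ≤ q ^ (-κ)) : (r * q) ^ σ ≤ q ^ s * ℓ ^ d * (r / ℓ) ^ t := by
  have hq0 : 0 < q := by linarith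
  have h1 : (r * q) ^ (σ - t) ≤ q ^ (s - t - η * d) := by
    rcases le_total σ t with h | h
    · exact (Real.rpow_le_one_of_one_le_of_nonpos hrq (by linarith)).trans
        (Real.one_le_rpow hq hparam')
    · refine le_trans ?_ (Real.rpow_le_rpow_of_exponent_le hq hparam)
      rw [Real.rpow_mul hq0.le]
      refine Real.rpow_le_rpow (by positivity) ?_ (by linarith)
      calc r * q ≤ q ^ (-κ) * q := by gcongr
        _ = _ := by rw [← Real.rpow_add_one hq0.ne']; ring_nf
  have h2 : q ^ (-(η * d)) ≤ ℓ ^ d := by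
    rw [← neg_mul, Real.rpow_mul hq0.le, Real.rpow_natCast]
    gcongr
  have h3 : r ^ t ≤ (r / ℓ) ^ t := by
    refine Real.rpow_le_rpow hr0.le ?_ ht
    rw [le_div_iff₀ hℓ0]
    nlinarith
  calc (r * q) ^ σ = (r * q) ^ (σ - t) * (r * q) ^ t := by
        rw [← Real.rpow_add (by positivity), sub_add_cancel]
    _ ≤ q ^ (s - t - η * d) * (r * q) ^ t := by gcongr
    _ = q ^ s * q ^ (-(η * d)) * r ^ t := by
        rw [Real.mul_rpow hr0.le hq0.le, mul_comm (r ^ t), ← mul_assoc, ← Real.rpow_add hq0,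
          ← Real.rpow_add hq0]
        ring_nf
    _ ≤ q ^ s * ℓ ^ d * (r / ℓ) ^ t := by gcongr

theorem IsDenominatorSet.rpow_le_sum_mass {d : ℕ} {γ γ' q ℓ : ℝ} {β : Fin d → ℝ} {𝓗 : Finset ℕ}
    (h : IsDenominatorSet γ γ' q 𝓗) (hq : 0 < q) (hℓ : 0 ≤ ℓ) :
    q ^ (((d : ℝ) + 1) * γ' + ∑ j, β j) * ℓ ^ d ≤ ∑ H ∈ 𝓗, mass (fun j => q ^ β j) ℓ H := by
  have h6 : ∀ x : ℝ, x ^ d = ∏ _j : Fin d, x := by simp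
  have h1 : ∀ H ∈ 𝓗, (∏ j, q ^ (γ' + β j)) * ℓ ^ d ≤ mass (fun j => q ^ β j) ℓ H := by
    intro H hH
    rw [mass, h6, ← Finset.prod_mul_distrib]
    refine Finset.prod_le_prod (fun j _ => by positivity) fun j _ => ?_
    rw [Real.rpow_add hq]
    have := h.rpow_le H hH
    gcongr
  have h2 := Finset.card_nsmul_le_sum _ _ _ h1
  refine le_trans ?_ h2
  have h7 : q ^ (((d : ℝ) + 1) * γ' + ∑ j, β j) = q ^ γ' * ∏ j, q ^ (γ' + β j) := by
    rw [← Real.rpow_sum_of_pos hq, ← Real.rpow_add hq, Finset.sum_add_distrib]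
    simp
    ring_nf
  rw [h7, nsmul_eq_mul, mul_assoc]
  have h8 : 0 ≤ (∏ j, q ^ (γ' + β j)) * ℓ ^ d :=
    mul_nonneg (Finset.prod_nonneg fun j _ => by positivity) (by positivity)
  exact mul_le_mul_of_nonneg_right h.rpow_le_card h8

theorem IsDenominatorSet.isCoprime {γ γ' q : ℝ} {𝓗 : Finset ℕ} (h : IsDenominatorSet γ γ' q 𝓗)
    {H H' : ℕ} (hH : H ∈ 𝓗) (hH' : H' ∈ 𝓗) (hne : H ≠ H') : IsCoprime (H : ℤ) (H' : ℤ) := by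
  rw [Nat.isCoprime_iff_coprime]
  rcases h.one_or_prime H hH with rfl | hp
  · simp
  rcases h.one_or_prime H' hH' with rfl | hp'
  · simp
  exact (Nat.coprime_primes hp hp').2 hne

theorem IsDenominatorSet.pos {γ γ' q : ℝ} {𝓗 : Finset ℕ} (h : IsDenominatorSet γ γ' q 𝓗)
    {H : ℕ} (hH : H ∈ 𝓗) : 0 < H := by
  rcases h.one_or_prime H hH with rfl | hp
  exacts [one_pos, hp.pos]

/-- The exponents entering the counting of close pairs of fractions. -/
structure Exponents {d : ℕ} (γ γ' : ℝ) (β : Fin d → ℝ) (t κ η : ℝ) : Prop where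
  nonneg_dim : 0 ≤ t
  dim_le : t ≤ d
  pos_gap : 0 < κ - η
  gap_le : ∀ j, κ ≤ γ' + β j
  nonneg_weight : ∀ j, 0 ≤ β j
  exponent_mem : ∀ j, 0 ≤ γ + β j ∧ γ + β j ≤ 1
  distinct : η * d ≤ (κ - η) * (d - t)
  same : (1 - κ) * (∑ j, (γ + β j) - t) ≤ ((d : ℝ) + 1) * γ' + ∑ j, β j - t - η * d
  same_nonneg : 0 ≤ ((d : ℝ) + 1) * γ' + ∑ j, β j - t - η * d

theorem Exponents.six_le {d : ℕ} {γ γ' : ℝ} {β : Fin d → ℝ} {t κ η : ℝ}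
    (he : Exponents γ γ' β t κ η) {q ℓ : ℝ} {𝓗 : Finset ℕ} (h : IsDenominatorSet γ γ' q 𝓗)
    (hq : 1 ≤ q) (hq6 : 6 ≤ q ^ (κ - η)) (hℓ : q ^ (-η) ≤ ℓ) {H : ℕ} (hH : H ∈ 𝓗)
    (j : Fin d) : q ^ κ ≤ H * q ^ β j ∧ 6 ≤ H * q ^ β j * ℓ := by
  have hq0 : 0 < q := by linarith
  have h1 : q ^ κ ≤ H * q ^ β j := by
    calc q ^ κ ≤ q ^ (γ' + β j) := Real.rpow_le_rpow_of_exponent_le hq (he.gap_le j)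
      _ = q ^ γ' * q ^ β j := Real.rpow_add hq0 _ _
      _ ≤ _ := by have := h.rpow_le H hH; gcongr
  refine ⟨h1, hq6.trans ?_⟩
  calc q ^ (κ - η) = q ^ κ * q ^ (-η) := by rw [← Real.rpow_add hq0]; ring_nf
    _ ≤ _ := mul_le_mul h1 hℓ (by positivity) (by positivity)

open Classical in
theorem sum_card_close_le_rpow {d : ℕ} {γ γ' : ℝ} {β : Fin d → ℝ} {t κ η : ℝ}
    (he : Exponents γ γ' β t κ η) {q ℓ r : ℝ} {𝓗 : Finset ℕ} (h : IsDenominatorSet γ γ' q 𝓗)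
    (hq : 1 ≤ q) (hq6 : 6 ≤ q ^ (κ - η)) (hℓ0 : 0 < ℓ) (hℓ1 : ℓ ≤ 1) (hℓ : q ^ (-η) ≤ ℓ)
    (hrq : q⁻¹ ≤ r) (hrℓ : r ≤ ℓ) (c : Fin d → ℝ) :
    ∑ a ∈ fractions (fun j => q ^ β j) c ℓ 𝓗,
        (((fractions (fun j => q ^ β j) c ℓ 𝓗).filter fun b =>
          dist (fracPoint (fun j => q ^ β j) a) (fracPoint (fun j => q ^ β j) b) ≤ r).card : ℝ) ≤
      2 * 96 ^ d * (fractions (fun j => q ^ β j) c ℓ 𝓗).card ^ 2 * (r / ℓ) ^ t := by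
  have hq0 : 0 < q := by linarith
  have hr0 : 0 < r := lt_of_lt_of_le (by positivity) hrq
  have hrq' : 1 ≤ r * q := by rwa [inv_le_iff_one_le_mul₀ hq0] at hrq
  set w : Fin d → ℝ := fun j => q ^ β j with hw
  have hw0 : ∀ j, 0 < w j := fun j => by positivity
  have hw1 : ∀ j, 1 ≤ w j := fun j => Real.one_le_rpow hq (he.nonneg_weight j)
  set N : ℝ := ((fractions w c ℓ 𝓗).card : ℝ) with hN
  set M : ℝ := ∑ H ∈ 𝓗, mass w ℓ H with hM
  have hmass : ∀ H, 0 ≤ mass w ℓ H := fun H =>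
    Finset.prod_nonneg fun j _ => by have := hw0 j; positivity
  have hM0 : 0 ≤ M := Finset.sum_nonneg fun H _ => hmass H
  have hMN : M ≤ 4 ^ d * N := sum_mass_le_card hw0 h.one_or_prime hℓ0.le
    fun H hH j => (he.six_le h hq hq6 hℓ hH j).2
  have hG : 0 ≤ (r / ℓ) ^ t := by positivity
  have hsq : M ^ 2 = ∑ H ∈ 𝓗, ∑ H' ∈ 𝓗, mass w ℓ H * mass w ℓ H' := by
    rw [sq, Finset.sum_mul_sum]
  have hpairs : ∑ H ∈ 𝓗, ∑ H' ∈ 𝓗, ∏ j, ((closePairs (w j) (c j) ℓ r H H').card : ℝ) ≤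
      2 * 6 ^ d * M ^ 2 * (r / ℓ) ^ t := by
    -- At r ≥ q^(-κ) every lattice has spacing at most r in each coordinate, and coprimality is not
    -- needed. Below that scale, equal and distinct denominators are treated apart.
    rcases le_total (q ^ (-κ)) r with hrκ | hrκ
    · have h1 : (r / ℓ) ^ d ≤ (r / ℓ) ^ t := by
        rw [← Real.rpow_natCast]
        exact Real.rpow_le_rpow_of_exponent_ge (by positivity) ((div_le_one hℓ0).2 hrℓ) he.dim_le
      have h2 : ∀ H ∈ 𝓗, ∀ H' ∈ 𝓗, ∏ j, ((closePairs (w j) (c j) ℓ r H H').card : ℝ) ≤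
          6 ^ d * (r / ℓ) ^ d * (mass w ℓ H * mass w ℓ H') := by
        intro H hH H' hH'
        refine prod_card_closePairs_le_of_large hw0 (h.pos hH) (h.pos hH') hℓ0 hr0.le
          (fun j => by linarith [(he.six_le h hq hq6 hℓ hH j).2]) fun j => ?_
        calc (1 : ℝ) = q ^ (-κ) * q ^ κ := by rw [← Real.rpow_add hq0]; simp
          _ ≤ _ := mul_le_mul hrκ (he.six_le h hq hq6 hℓ hH' j).1 (by positivity) hr0.le
      calc _ ≤ ∑ H ∈ 𝓗, ∑ H' ∈ 𝓗, 6 ^ d * (r / ℓ) ^ d * (mass w ℓ H * mass w ℓ H') :=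
            Finset.sum_le_sum fun H hH => Finset.sum_le_sum fun H' hH' => h2 H hH H' hH'
        _ = 6 ^ d * (r / ℓ) ^ d * M ^ 2 := by rw [hsq]; simp only [Finset.mul_sum]
        _ ≤ 6 ^ d * (r / ℓ) ^ t * M ^ 2 := by gcongr
        _ ≤ _ := by nlinarith [show 0 ≤ 6 ^ d * (r / ℓ) ^ t * M ^ 2 by positivity]
    · have h1 := div_pow_mul_inv_pow_le hq he.dim_le he.distinct hℓ0 hℓ hr0 hrκ
      have h2 := mul_rpow_le_of_small hq he.nonneg_dim he.same he.same_nonneg hℓ0 hℓ1 hℓ hrq' hr0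
        hrκ
      have h3 : (r * q) ^ (∑ j, (γ + β j)) ≤ M * (r / ℓ) ^ t :=
        h2.trans (mul_le_mul_of_nonneg_right (h.rpow_le_sum_mass hq0 hℓ0.le) hG)
      have h4 : ∀ H ∈ 𝓗, ∀ H' ∈ 𝓗, ∏ j, ((closePairs (w j) (c j) ℓ r H H').card : ℝ) ≤
          4 ^ d * (r / ℓ) ^ t * (mass w ℓ H * mass w ℓ H') +
            if H = H' then 6 ^ d * (M * (r / ℓ) ^ t) * mass w ℓ H else 0 := by
        intro H hH H' hH'
        have h0 : 0 ≤ mass w ℓ H * mass w ℓ H' := mul_nonneg (hmass _) (hmass _)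
        split_ifs with hHH
        · subst hHH
          refine le_add_of_nonneg_of_le (by positivity) ?_
          refine (prod_card_closePairs_self_le (a := fun j => γ + β j) hw0 (h.pos hH) hℓ0 hr0.le
            (fun j => by linarith [(he.six_le h hq hq6 hℓ hH j).2]) hrq' (hrℓ.trans hℓ1)
            he.exponent_mem fun j => ?_).trans ?_
          · rw [Real.rpow_add hq0]
            have := h.le_rpow H hH
            gcongr
          · have := hmass H
            gcongr
        · rw [add_zero]
          refine (prod_card_closePairs_le_of_coprime hw1 (h.pos hH) (h.pos hH') hHH
            (h.isCoprime hH hH' hHH) hℓ0 hℓ1 hr0.le).trans ?_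
          gcongr
      calc _ ≤ ∑ H ∈ 𝓗, ∑ H' ∈ 𝓗, (4 ^ d * (r / ℓ) ^ t * (mass w ℓ H * mass w ℓ H') +
            if H = H' then 6 ^ d * (M * (r / ℓ) ^ t) * mass w ℓ H else 0) :=
            Finset.sum_le_sum fun H hH => Finset.sum_le_sum fun H' hH' => h4 H hH H' hH'
        _ = 4 ^ d * (r / ℓ) ^ t * M ^ 2 + 6 ^ d * (M * (r / ℓ) ^ t) * M := by
            simp only [Finset.sum_add_distrib]
            congr 1
            · rw [hsq]; simp only [Finset.mul_sum]
            · rw [hM, Finset.mul_sum]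
              refine Finset.sum_congr rfl fun H hH => ?_
              rw [Finset.sum_ite_eq, if_pos hH]
        _ ≤ 6 ^ d * (r / ℓ) ^ t * M ^ 2 + 6 ^ d * (M * (r / ℓ) ^ t) * M := by
            gcongr
            norm_num
        _ = _ := by ring
  have hcast := sum_card_close_le w c ℓ 𝓗 hr0.le
  have hcast' : ∑ a ∈ fractions w c ℓ 𝓗,
      (((fractions w c ℓ 𝓗).filter fun b => dist (fracPoint w a) (fracPoint w b) ≤ r).card : ℝ) ≤
      ∑ H ∈ 𝓗, ∑ H' ∈ 𝓗, ∏ j, ((closePairs (w j) (c j) ℓ r H H').card : ℝ) := by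
    exact_mod_cast hcast
  refine (hcast'.trans hpairs).trans ?_
  calc 2 * 6 ^ d * M ^ 2 * (r / ℓ) ^ t ≤ 2 * 6 ^ d * (4 ^ d * N) ^ 2 * (r / ℓ) ^ t := by gcongr
    _ = 2 * (6 * 4 * 4) ^ d * N ^ 2 * (r / ℓ) ^ t := by rw [mul_pow, mul_pow, mul_pow]; ring
    _ = _ := by norm_num

/-! ### From pair counts to well-distributed children -/

-- Let Φ a sum the neighbour counts at dyadic scales with weights 2^(k t₀). The pair bound makes the
-- average of Φ at most AGN, the geometric series converging because t₀ < t. By Markov at least half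
-- of P has Φ ≤ 2AGN, and each single term of Φ then obeys this bound.
open Classical in
theorem exists_regular_subset {ι X : Type*} [MetricSpace X] {P : Finset ι} (y : ι → X)
    (hP : P.Nonempty) {A ℓ t t₀ δ : ℝ} (hA : 0 < A) (ht : t₀ < t) (hℓ : 0 < ℓ) (hδ : 0 < δ)
    (hpairs : ∀ r, δ ≤ r → r ≤ ℓ →
      ∑ a ∈ P, ((P.filter fun b => dist (y a) (y b) ≤ r).card : ℝ) ≤
        A * P.card ^ 2 * (r / ℓ) ^ t) :
    ∃ S ⊆ P, S.Nonempty ∧ ∀ a ∈ S, ∀ k : ℕ, δ ≤ ℓ / 2 ^ k →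
      ((S.filter fun b => dist (y a) (y b) ≤ ℓ / 2 ^ k).card : ℝ) ≤
        4 * A * (1 - 2 ^ (t₀ - t))⁻¹ * S.card * (((2 : ℝ) ^ k) ^ t₀)⁻¹ := by
  set x : ℝ := 2 ^ (t₀ - t) with hx
  have hx0 : 0 < x := by positivity
  have hx1 : x < 1 := Real.rpow_lt_one_of_one_lt_of_neg (by norm_num) (by linarith)
  set G : ℝ := (1 - x)⁻¹ with hG
  have hG0 : 0 < G := inv_pos.2 (by linarith)
  set N : ℝ := (P.card : ℝ) with hN
  have hN0 : 0 < N := Nat.cast_pos.2 hP.card_pos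
  set K : Finset ℕ := (Finset.range (⌊ℓ / δ⌋₊ + 1)).filter fun k => δ ≤ ℓ / 2 ^ k with hK
  have hKmem : ∀ k, δ ≤ ℓ / 2 ^ k → k ∈ K := by
    intro k hk
    refine Finset.mem_filter.2 ⟨Finset.mem_range.2 (Nat.lt_succ_of_le (Nat.le_floor ?_)), hk⟩
    rw [le_div_iff₀ (by positivity)] at hk
    rw [le_div_iff₀ hδ]
    have h1 : (k : ℝ) ≤ 2 ^ k := by exact_mod_cast Nat.lt_two_pow_self.le
    nlinarith
  set Φ : ι → ℝ := fun a => ∑ k ∈ K, ((2 : ℝ) ^ k) ^ t₀ *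
    ((P.filter fun b => dist (y a) (y b) ≤ ℓ / 2 ^ k).card : ℝ) with hΦ
  have hΦ0 : ∀ a, 0 ≤ Φ a := fun a => Finset.sum_nonneg fun k _ => by positivity
  have hsum : ∑ a ∈ P, Φ a ≤ A * N ^ 2 * G := by
    rw [hΦ, Finset.sum_comm]
    have h1 : ∀ k ∈ K, ∑ a ∈ P, ((2 : ℝ) ^ k) ^ t₀ *
        ((P.filter fun b => dist (y a) (y b) ≤ ℓ / 2 ^ k).card : ℝ) ≤ A * N ^ 2 * x ^ k := by
      intro k hk
      rw [← Finset.mul_sum]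
      have h2 := hpairs (ℓ / 2 ^ k) (Finset.mem_filter.1 hk).2
        (div_le_self hℓ.le (one_le_pow₀ (by norm_num)))
      have h3 : ((2 : ℝ) ^ k) ^ t₀ * (ℓ / 2 ^ k / ℓ) ^ t = x ^ k := by
        have h4 : ℓ / 2 ^ k / ℓ = ((2 : ℝ) ^ k)⁻¹ := by field_simp
        rw [h4, Real.inv_rpow (by positivity), ← Real.rpow_neg (by positivity),
          ← Real.rpow_add (by positivity), hx, ← Real.rpow_natCast, ← Real.rpow_natCast,
          ← Real.rpow_mul (by norm_num), ← Real.rpow_mul (by norm_num)]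
        ring_nf
      calc _ ≤ ((2 : ℝ) ^ k) ^ t₀ * (A * N ^ 2 * (ℓ / 2 ^ k / ℓ) ^ t) := by gcongr
        _ = A * N ^ 2 * (((2 : ℝ) ^ k) ^ t₀ * (ℓ / 2 ^ k / ℓ) ^ t) := by ring
        _ = _ := by rw [h3]
    refine (Finset.sum_le_sum h1).trans ?_
    rw [← Finset.mul_sum]
    gcongr
    rw [hG, ← tsum_geometric_of_lt_one hx0.le hx1]
    exact (summable_geometric_of_lt_one hx0.le hx1).sum_le_tsum _ fun k _ => by positivity
  set S : Finset ι := P.filter fun a => Φ a ≤ 2 * A * G * N with hS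
  have hScard : N ≤ 2 * S.card := by
    by_contra! hlt
    have h1 := Finset.card_filter_add_card_filter_not (s := P) (fun a => Φ a ≤ 2 * A * G * N)
    have h2 : (S.card : ℝ) + ((P.filter fun a => ¬ Φ a ≤ 2 * A * G * N).card : ℝ) = N := by
      rw [← Nat.cast_add]
      exact congrArg Nat.cast h1
    have h3 := Finset.card_nsmul_le_sum (P.filter fun a => ¬ Φ a ≤ 2 * A * G * N) Φ
      (2 * A * G * N) fun a ha => (not_le.1 (Finset.mem_filter.1 ha).2).le
    have h4 := Finset.sum_le_sum_of_subset_of_nonneg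
      (Finset.filter_subset (fun a => ¬ Φ a ≤ 2 * A * G * N) P) fun a _ _ => hΦ0 a
    rw [nsmul_eq_mul] at h3
    have h5 : N / 2 < ((P.filter fun a => ¬ Φ a ≤ 2 * A * G * N).card : ℝ) := by linarith
    have h6 : 0 < 2 * A * G * N := by positivity
    have h7 := mul_lt_mul_of_pos_right h5 h6
    nlinarith
  refine ⟨S, Finset.filter_subset _ _, ?_, ?_⟩
  · rw [← Finset.card_pos]
    have : (0 : ℝ) < S.card := by linarith
    exact_mod_cast this
  · intro a ha k hk
    have h1 : Φ a ≤ 2 * A * G * N := (Finset.mem_filter.1 ha).2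
    have h2 : ((2 : ℝ) ^ k) ^ t₀ *
        ((P.filter fun b => dist (y a) (y b) ≤ ℓ / 2 ^ k).card : ℝ) ≤ Φ a :=
      Finset.single_le_sum (f := fun k => ((2 : ℝ) ^ k) ^ t₀ *
        ((P.filter fun b => dist (y a) (y b) ≤ ℓ / 2 ^ k).card : ℝ))
        (fun k _ => by positivity) (hKmem k hk)
    have h3 : ((S.filter fun b => dist (y a) (y b) ≤ ℓ / 2 ^ k).card : ℝ) ≤
        ((P.filter fun b => dist (y a) (y b) ≤ ℓ / 2 ^ k).card : ℝ) := by
      exact_mod_cast Finset.card_le_card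
        (Finset.filter_subset_filter _ (Finset.filter_subset _ _))
    rw [← div_eq_mul_inv, le_div_iff₀ (by positivity)]
    calc _ ≤ ((2 : ℝ) ^ k) ^ t₀ *
        ((P.filter fun b => dist (y a) (y b) ≤ ℓ / 2 ^ k).card : ℝ) := by
          rw [mul_comm]; gcongr
      _ ≤ 2 * A * G * N := h2.trans h1
      _ ≤ 2 * A * G * (2 * S.card) := by gcongr
      _ = _ := by ring

-- Children that meet one set U have centres within r + 2δ ≤ 3R of each other. The dyadic scale just
-- above 3R satisfies 2^(-k) < 6R/ℓ, whence the factor 6^t; if 3R > ℓ the bound is trivial.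
open Classical in
theorem hasChildren_of_card_le {ι X : Type*} [MetricSpace X] {S : Finset ι} {y : ι → X}
    (hS : S.Nonempty) {B ℓ t δ : ℝ} (ht : 0 ≤ t) (hℓ : 0 < ℓ) (hδℓ : δ ≤ ℓ / 2)
    (hreg : ∀ a ∈ S, ∀ k : ℕ, δ ≤ ℓ / 2 ^ k →
      ((S.filter fun b => dist (y a) (y b) ≤ ℓ / 2 ^ k).card : ℝ) ≤
        B * S.card * (((2 : ℝ) ^ k) ^ t)⁻¹)
    {F : Set X} {c : X} (hc : ∀ a ∈ S, dist (y a) c ≤ ℓ / 2)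
    (hF : ∀ a ∈ S, Metric.closedBall (y a) δ ⊆ F) :
    HasChildren ι (6 ^ t * max 1 B) t ℓ δ F c := by
  refine ⟨S, y, hS, fun a ha => ⟨?_, hF a ha⟩, fun U r hr hU => ?_⟩
  · exact Metric.closedBall_subset_closedBall' (by linarith [hc a ha])
  set R := max r δ with hR
  have hR0 : 0 < R := lt_max_of_lt_left hr
  have hset : {a ∈ (S : Set ι) | (Metric.closedBall (y a) δ ∩ U).Nonempty} =
      (S.filter fun a => (Metric.closedBall (y a) δ ∩ U).Nonempty : Finset ι) := by
    ext a; simp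
  rw [hset, ncard_coe_finset]
  set T := S.filter fun a => (Metric.closedBall (y a) δ ∩ U).Nonempty with hT
  have hTS : (T.card : ℝ) ≤ S.card := by exact_mod_cast Finset.card_filter_le _ _
  have hmax : (1 : ℝ) ≤ max 1 B := le_max_left _ _
  rcases T.eq_empty_or_nonempty with h0 | ⟨a, ha⟩
  · rw [h0]
    simp only [Finset.card_empty, Nat.cast_zero]
    positivity
  have h6 : (6 : ℝ) ^ t * (R / ℓ) ^ t = (6 * R / ℓ) ^ t := by
    rw [← Real.mul_rpow (by norm_num) (by positivity), mul_div_assoc]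
  have key : 6 ^ t * max 1 B * S.card * (R / ℓ) ^ t = max 1 B * S.card * (6 * R / ℓ) ^ t := by
    rw [← h6]; ring
  rw [key]
  rcases lt_or_ge ℓ (3 * R) with h3 | h3
  · have h4 : 1 ≤ (6 * R / ℓ) ^ t := Real.one_le_rpow (by rw [one_le_div hℓ]; linarith) ht
    calc (T.card : ℝ) ≤ 1 * S.card * 1 := by linarith
      _ ≤ _ := by gcongr
  · obtain ⟨k, hk1, hk2⟩ := exists_nat_pow_near (x := ℓ / (3 * R)) (y := 2)
      (by rw [one_le_div (by positivity)]; exact h3) one_lt_two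
    have hk3 : 3 * R ≤ ℓ / 2 ^ k := by
      rw [le_div_iff₀ (by positivity)] at hk1 ⊢
      linarith
    have hTsub : T ⊆ S.filter fun b => dist (y a) (y b) ≤ ℓ / 2 ^ k := by
      intro b hb
      obtain ⟨u, hu, huU⟩ := (Finset.mem_filter.1 ha).2
      obtain ⟨v, hv, hvU⟩ := (Finset.mem_filter.1 hb).2
      refine Finset.mem_filter.2 ⟨(Finset.mem_filter.1 hb).1, le_trans ?_ hk3⟩
      have h4 := dist_triangle4 (y a) u v (y b)
      rw [Metric.mem_closedBall, dist_comm] at hu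
      rw [Metric.mem_closedBall] at hv
      have h5 := hU u huU v hvU
      have h6 : r ≤ R := le_max_left _ _
      have h7 : δ ≤ R := le_max_right _ _
      linarith
    have h8 := hreg a (Finset.mem_filter.1 ha).1 k ((le_max_right r δ).trans (by linarith))
    have h9 : (((2 : ℝ) ^ k) ^ t)⁻¹ ≤ (6 * R / ℓ) ^ t := by
      rw [← Real.inv_rpow (by positivity)]
      refine Real.rpow_le_rpow (by positivity) ?_ ht
      rw [inv_le_iff_one_le_mul₀ (by positivity), div_mul_eq_mul_div, one_le_div hℓ]
      rw [div_lt_iff₀ (by positivity), pow_succ] at hk2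
      linarith
    calc (T.card : ℝ) ≤ _ := by exact_mod_cast Finset.card_le_card hTsub
      _ ≤ _ := h8
      _ ≤ max 1 B * S.card * (6 * R / ℓ) ^ t := by
          gcongr
          exact le_max_right _ _

/-- The points of `ℝ^d`, with the maximum norm, that are approximable at level `q`. -/
def supLevel {d : ℕ} (γ : ℝ) (β : Fin d → ℝ) (q : ℝ) : Set (Fin d → ℝ) :=
  {x | ∃ H : ℕ, 1 ≤ H ∧ (H : ℝ) ≤ q ^ γ ∧
    ∃ p : Fin d → ℤ, ∀ j, |x j - p j / (H * q ^ β j)| ≤ q⁻¹}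

theorem Exponents.hasChildren {d : ℕ} {γ γ' : ℝ} {β : Fin d → ℝ} {t t₀ κ η : ℝ}
    (he : Exponents γ γ' β t κ η) (ht₀ : 0 ≤ t₀) (ht : t₀ < t) {q ℓ : ℝ} {𝓗 : Finset ℕ}
    (h : IsDenominatorSet γ γ' q 𝓗) (hq : 1 ≤ q) (hq6 : 6 ≤ q ^ (κ - η)) (hℓ0 : 0 < ℓ)
    (hℓ1 : ℓ ≤ 1) (hℓ : q ^ (-η) ≤ ℓ) (hqℓ : q⁻¹ ≤ ℓ / 2) (c : Fin d → ℝ) :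
    HasChildren (Σ _ : ℕ, Fin d → ℤ)
      (6 ^ t₀ * max 1 (4 * (2 * 96 ^ d) * (1 - 2 ^ (t₀ - t))⁻¹)) t₀ ℓ q⁻¹ (supLevel γ β q) c := by
  have hq0 : 0 < q := by linarith
  set w : Fin d → ℝ := fun j => q ^ β j with hw
  have hw0 : ∀ j, 0 < w j := fun j => by positivity
  have hne : (fractions w c ℓ 𝓗).Nonempty := by
    have h1 := h.rpow_le_sum_mass (β := β) hq0 hℓ0.le
    have h2 := sum_mass_le_card (c := c) hw0 h.one_or_prime hℓ0.le
      fun H hH j => (he.six_le h hq hq6 hℓ hH j).2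
    have h3 : 0 < q ^ (((d : ℝ) + 1) * γ' + ∑ j, β j) * ℓ ^ d := by positivity
    rw [← Finset.card_pos]
    have h4 : (0 : ℝ) < (fractions w c ℓ 𝓗).card := by
      by_contra! h5
      have h6 : (0 : ℝ) < 4 ^ d := by positivity
      nlinarith
    exact_mod_cast h4
  obtain ⟨S, hSP, hS, hreg⟩ := exists_regular_subset (fracPoint w) hne
    (A := 2 * 96 ^ d) (by positivity) ht hℓ0 (inv_pos.2 hq0)
    fun r hr1 hr2 => sum_card_close_le_rpow he h hq hq6 hℓ0 hℓ1 hℓ hr1 hr2 c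
  have hmem : ∀ a ∈ S, a.1 ∈ 𝓗 ∧ ∀ j, a.2 j ∈ numerators (w j) (c j) ℓ a.1 := fun a ha => by
    obtain ⟨h1, h2⟩ := Finset.mem_sigma.1 (hSP ha)
    exact ⟨h1, fun j => Fintype.mem_piFinset.1 h2 j⟩
  refine hasChildren_of_card_le hS ht₀ hℓ0 hqℓ hreg (fun a ha => ?_)
    fun a ha x hx => ?_
  · rw [dist_pi_le_iff (by positivity)]
    intro j
    rw [Real.dist_eq]
    exact ((mem_numerators (hw0 j) (h.pos (hmem a ha).1)).1 ((hmem a ha).2 j)).1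
  · rw [Metric.mem_closedBall, dist_pi_le_iff (by positivity)] at hx
    refine ⟨a.1, h.pos (hmem a ha).1, h.le_rpow _ (hmem a ha).1, a.2, fun j => ?_⟩
    have := hx j
    rwa [Real.dist_eq] at this

/-! ### Choice of the exponents -/

theorem exists_loss {D t κ s u : ℝ} (hD : 0 < D) (htD : t < D) (hκ : 0 < κ) (hs : t < s)
    (hu : u < s - t) : ∃ η, 0 < η ∧ 0 < κ - η ∧ η * D ≤ (κ - η) * (D - t) ∧ u ≤ s - t - η * D ∧
      0 ≤ s - t - η * D := by
  have h1 : 0 < κ / 2 * (D - t) / D := div_pos (mul_pos (by linarith) (by linarith)) hD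
  have h2 : 0 < (s - t) / D := div_pos (by linarith) hD
  have h3 : 0 < (s - t - u) / D := div_pos (by linarith) hD
  obtain ⟨η, hη0, hη⟩ := exists_between (lt_min (half_pos hκ) (lt_min h1 (lt_min h2 h3)))
  obtain ⟨ha, hη⟩ := lt_min_iff.1 hη
  obtain ⟨hb, hη⟩ := lt_min_iff.1 hη
  obtain ⟨hc, hd⟩ := lt_min_iff.1 hη
  rw [lt_div_iff₀ hD] at hb hc hd
  exact ⟨η, hη0, by linarith, by nlinarith, by linarith, by linarith⟩

theorem exists_exponents {d : ℕ} (hd : 1 ≤ d) {γ : ℝ} {β : Fin d → ℝ} (hγ : 0 ≤ γ)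
    (hβ : ∀ j, 0 ≤ β j) (hγβ : ∀ j, 0 < γ + β j ∧ γ + β j < 1) {t : ℝ} (ht0 : 0 ≤ t)
    (hts : t < ((d : ℝ) + 1) * γ + ∑ j, β j) (htd : t < d) :
    ∃ γ' κ η, Exponents γ γ' β t κ η ∧ 0 < η ∧
      ∀ᶠ q : ℝ in atTop, ∃ 𝓗, IsDenominatorSet γ γ' q 𝓗 := by
  have hd0 : (0 : ℝ) < d := by exact_mod_cast hd
  have hσ : ∑ j, (γ + β j) = d * γ + ∑ j, β j := by simp [Finset.sum_add_distrib]
  obtain ⟨γ', hγ'β, hts', hσs', hden⟩ : ∃ γ', (∀ j, 0 < γ' + β j) ∧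
      t < ((d : ℝ) + 1) * γ' + ∑ j, β j ∧
      (∀ κ, 0 < κ → κ ≤ 1 → (1 - κ) * (∑ j, (γ + β j) - t) <
        ((d : ℝ) + 1) * γ' + ∑ j, β j - t) ∧
      ∀ᶠ q : ℝ in atTop, ∃ 𝓗, IsDenominatorSet γ γ' q 𝓗 := by
    rcases hγ.eq_or_lt with rfl | hγ
    · refine ⟨0, fun j => (hγβ j).1, hts, fun κ hκ _ => ?_,
        Eventually.of_forall fun q => ⟨{1}, isDenominatorSet_zero q⟩⟩
      rw [hσ]
      nlinarith
    · have h1 : max (0 : ℝ) (max (d * γ / (d + 1)) ((t - ∑ j, β j) / (d + 1))) < γ := by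
        refine max_lt hγ (max_lt ?_ ?_)
        · rw [div_lt_iff₀ (by positivity)]; linarith
        · rw [div_lt_iff₀ (by positivity)]; linarith
      obtain ⟨γ', h2, h3⟩ := exists_between h1
      obtain ⟨h4, h2⟩ := max_lt_iff.1 h2
      obtain ⟨h5, h6⟩ := max_lt_iff.1 h2
      rw [div_lt_iff₀ (by positivity)] at h5 h6
      refine ⟨γ', fun j => by linarith [hβ j], by linarith, fun κ hκ hκ1 => ?_,
        eventually_exists_isDenominatorSet h4 h3⟩
      rw [hσ]
      rcases le_total (d * γ + ∑ j, β j) t with h7 | h7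
      · nlinarith
      · nlinarith
  obtain ⟨κ, hκ0, hκ1, hκ⟩ : ∃ κ : ℝ, 0 < κ ∧ κ ≤ 1 ∧ ∀ j, κ ≤ γ' + β j := by
    have : Nonempty (Fin d) := ⟨⟨0, hd⟩⟩
    obtain ⟨j₀, hj₀⟩ := Finite.exists_min fun j => γ' + β j
    exact ⟨min 1 (γ' + β j₀), lt_min one_pos (hγ'β j₀), min_le_left _ _,
      fun j => (min_le_right _ _).trans (hj₀ j)⟩
  obtain ⟨η, hη0, hη1, hη2, hη3, hη4⟩ := exists_loss hd0 htd hκ0 hts' (hσs' κ hκ0 hκ1)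
  exact ⟨γ', κ, η, ⟨ht0, htd.le, hη1, hκ, hβ, fun j => ⟨(hγβ j).1.le, (hγβ j).2.le⟩, hη2, hη3, hη4⟩, hη0, hden⟩

/-! ### Lower bound and conclusion -/

/-- The exponent 10d(i+1) in the growth condition is unbounded in i, so eventually it exceeds 1/η,
for any η > 0. -/
theorem GrowsFast.eventually_rpow_neg_le {d : ℕ} (hd : 1 ≤ d) {γ : ℝ} {β : Fin d → ℝ} {q : ℕ → ℝ}
    (h : GrowsFast γ β q) {η : ℝ} (hη : 0 < η) :
    ∀ᶠ i in atTop, q (i + 1) ^ (-η) ≤ (q i)⁻¹ := by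
  obtain ⟨n, hn⟩ := exists_nat_gt (1 / η)
  filter_upwards [eventually_ge_atTop n, eventually_ge_atTop 1] with i hi hi1
  have hq1 := h.1 i hi1
  have hq0 : 0 < q i := by linarith
  have h1 := (h.2.2 i hi1).1.le
  have hq' : 0 < q (i + 1) := lt_of_lt_of_le (by positivity) h1
  rw [Real.rpow_neg hq'.le]
  refine inv_anti₀ hq0 ?_
  have h2 : 1 ≤ ((10 * d * (i + 1) : ℕ) : ℝ) * η := by
    have h3 : (1 : ℝ) / η < (10 * d * (i + 1) : ℕ) := by
      refine hn.trans_le ?_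
      have : n ≤ 10 * d * (i + 1) := by nlinarith
      exact_mod_cast this
    rw [div_lt_iff₀ hη] at h3
    exact h3.le
  calc q i = q i ^ (1 : ℝ) := (Real.rpow_one _).symm
    _ ≤ q i ^ (((10 * d * (i + 1) : ℕ) : ℝ) * η) := Real.rpow_le_rpow_of_exponent_le hq1.le h2
    _ = (q i ^ (10 * d * (i + 1))) ^ η := by rw [Real.rpow_mul hq0.le, Real.rpow_natCast]
    _ ≤ q (i + 1) ^ η := Real.rpow_le_rpow (by positivity) h1 hη.le

theorem closedBall_inter_subset_supSet {d : ℕ} {γ : ℝ} {β : Fin d → ℝ} {q : ℕ → ℝ} (hγ : 0 ≤ γ)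
    (h : GrowsFast γ β q) {n : ℕ} (hn : 1 ≤ n) :
    Metric.closedBall 0 (q n)⁻¹ ∩ ⋂ k, supLevel γ β (q (n + k + 1)) ⊆ supSet γ β q := by
  rintro x ⟨hx, hx'⟩ i hi
  have hqn := h.1 n hn
  rcases le_or_gt i n with hin | hin
  · have hqi := h.1 i hi
    -- The levels before the construction starts cost nothing: the cube about 0 of radius 1/q_n lies
    -- within 1/q_i of the lattice point 0.
    refine ⟨1, le_rfl, ?_, 0, fun j => ?_⟩
    · rw [Nat.cast_one]
      exact Real.one_le_rpow hqi.le hγ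
    · rw [Metric.mem_closedBall, dist_pi_le_iff (by positivity)] at hx
      have h1 := hx j
      rw [Real.dist_eq, Pi.zero_apply, sub_zero] at h1
      simp only [Pi.zero_apply, Int.cast_zero, zero_div, sub_zero]
      exact h1.trans (inv_anti₀ (by linarith) (h.2.1.monotoneOn hi hn hin))
  · have h1 := mem_iInter.1 hx' (i - n - 1)
    rwa [show n + (i - n - 1) + 1 = i by omega] at h1

theorem le_dimH_supSet {d : ℕ} (hd : 1 ≤ d) {γ : ℝ} {β : Fin d → ℝ} (hγ : 0 ≤ γ)
    (hβ : ∀ j, 0 ≤ β j) (hγβ : ∀ j, 0 < γ + β j ∧ γ + β j < 1) {q : ℕ → ℝ}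
    (h : GrowsFast γ β q) {τ : ℝ} (hτ : 0 < τ) (hτs : τ < ((d : ℝ) + 1) * γ + ∑ j, β j)
    (hτd : τ < d) : ENNReal.ofReal τ ≤ dimH (supSet γ β q) := by
  -- Two gaps are needed: t₀ < t for the geometric series in the constant C, and τ < t₀ to absorb C
  -- at every level.
  obtain ⟨t, hτt, ht⟩ := exists_between (lt_min hτs hτd)
  obtain ⟨t₀, hτt₀, ht₀⟩ := exists_between hτt
  obtain ⟨hts, htd⟩ := lt_min_iff.1 ht
  obtain ⟨γ', κ, η, he, hη, hden⟩ := exists_exponents hd hγ hβ hγβ (by linarith) hts htd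
  set C : ℝ := 6 ^ t₀ * max 1 (4 * (2 * 96 ^ d) * (1 - 2 ^ (t₀ - t))⁻¹) with hC
  have hC1 : 1 ≤ C := one_le_mul_of_one_le_of_one_le
    (Real.one_le_rpow (by norm_num) (by linarith)) (le_max_left _ _)
  have hq := h.tendsto hd
  have hsucc : Tendsto (fun i => q (i + 1)) atTop atTop := (tendsto_add_atTop_iff_nat 1).2 hq
  have hlim : Tendsto (fun i => C * q i ^ (-(t₀ - τ))) atTop (𝓝 0) := by
    have := ((tendsto_rpow_neg_atTop (sub_pos.2 hτt₀)).comp hq).const_mul C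
    simpa using this
  have hev := ((hsucc.eventually hden).and (hsucc.eventually
    ((tendsto_rpow_atTop he.pos_gap).eventually_ge_atTop 6))).and
    ((h.eventually_rpow_neg_le hd hη).and ((hq.eventually_ge_atTop 2).and
      ((hlim.eventually (ge_mem_nhds one_pos)).and (eventually_ge_atTop 1))))
  obtain ⟨n, hn⟩ := eventually_atTop.1 hev
  have hn1 : 1 ≤ n := (hn n le_rfl).2.2.2.2
  set ρ : ℕ → ℝ := fun k => (q (n + k))⁻¹ with hρ
  have hqk : ∀ k, 2 ≤ q (n + k) := fun k => (hn (n + k) (by omega)).2.2.1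
  have hρ0 : ∀ k, 0 < ρ k := fun k => inv_pos.2 (by linarith [hqk k])
  have hρlim : Tendsto ρ atTop (𝓝 0) := by
    refine tendsto_inv_atTop_zero.comp (hq.comp ?_)
    exact tendsto_atTop_mono (fun k => Nat.le_add_left k n) tendsto_id
  have hsq : ∀ k, q (n + k) ^ 2 ≤ q (n + k + 1) := fun k => h.sq_le hd (by omega)
  have hsmall : ∀ k, C * (ρ (k + 1) / ρ k) ^ (t₀ - τ) ≤ 1 := by
    intro k
    refine le_trans ?_ (hn (n + k) (by omega)).2.2.2.1
    have h1 := hqk k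
    have h2 : 0 < q (n + k) := by linarith
    have h3 : 0 < q (n + (k + 1)) := by linarith [hqk (k + 1)]
    rw [Real.rpow_neg h2.le, ← Real.inv_rpow h2.le]
    refine mul_le_mul_of_nonneg_left (Real.rpow_le_rpow (div_nonneg (hρ0 _).le (hρ0 _).le) ?_
      (sub_pos.2 hτt₀).le) (by linarith)
    change (q (n + (k + 1)))⁻¹ / (q (n + k))⁻¹ ≤ (q (n + k))⁻¹
    have h4 := hsq k
    rw [add_assoc] at h4
    rw [div_le_iff₀ (by positivity), ← mul_inv, ← sq]
    exact inv_anti₀ (by positivity) h4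
  have hchild : ∀ k c, HasChildren (Σ _ : ℕ, Fin d → ℤ) C t₀ (ρ k) (ρ (k + 1))
      (supLevel γ β (q (n + k + 1))) c := by
    intro k c
    obtain ⟨⟨⟨𝓗, h𝓗⟩, h6⟩, h7, -⟩ := hn (n + k) (by omega)
    have h1 := hqk k
    have h2 := hsq k
    refine he.hasChildren (by linarith) ht₀ h𝓗 (by nlinarith) h6 (hρ0 k)
      (inv_le_one_of_one_le₀ (by linarith)) h7 ?_ c
    change (q (n + k + 1))⁻¹ ≤ (q (n + k))⁻¹ / 2
    rw [div_eq_mul_inv, ← mul_inv]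
    exact inv_anti₀ (by positivity) (by nlinarith)
  have hne := hausdorffMeasure_ne_zero_of_hasChildren hC1 hτ hτt₀ hρ0 hρlim hsmall hchild 0
  refine le_trans ?_ (dimH_mono (closedBall_inter_subset_supSet hγ h hn1))
  rw [ENNReal.ofReal]
  refine le_dimH_of_hausdorffMeasure_ne_zero ?_
  rw [Real.coe_toNNReal _ hτ.le]
  exact hne

theorem GrowsFast.dimH_approxSet_eq {d : ℕ} (hd : 1 ≤ d) {γ : ℝ} {β : Fin d → ℝ} (hγ : 0 ≤ γ)
    (hβ : ∀ j, 0 ≤ β j) (hγβ : ∀ j, 0 < γ + β j ∧ γ + β j < 1) {q : ℕ → ℝ}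
    (h : GrowsFast γ β q) :
    dimH (approxSet γ β q) = ENNReal.ofReal (min (((d : ℝ) + 1) * γ + ∑ j, β j) (d : ℝ)) := by
  rw [dimH_approxSet γ β q fun i hi => one_pos.trans (h.1 i hi)]
  refine le_antisymm ?_ (le_of_forall_lt_imp_le_of_dense fun a ha => ?_)
  · rw [ENNReal.ofReal_min]
    refine le_min (dimH_supSet_le hγ hβ h.1 (h.tendsto hd)) ?_
    refine (dimH_mono (subset_univ _)).trans ?_
    rw [Real.dimH_univ_pi_fin, ENNReal.ofReal_natCast]
  · have ha' : a ≠ ∞ := (ha.trans ENNReal.ofReal_lt_top).ne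
    rcases eq_or_ne a 0 with rfl | ha0
    · exact zero_le
    rw [← ENNReal.ofReal_toReal ha'] at ha ⊢
    have h1 := (ENNReal.ofReal_lt_ofReal_iff_of_nonneg ENNReal.toReal_nonneg).1 ha
    exact le_dimH_supSet hd hγ hβ hγβ h (ENNReal.toReal_pos ha0 ha') (lt_min_iff.1 h1).1
      (lt_min_iff.1 h1).2

end DiophantineLiminf

theorem theorem1p1 (d : ℕ) (hd : 1 ≤ d) (γ : ℝ) (β : Fin d → ℝ)
    (hγ : 0 ≤ γ) (hβ : ∀ j, 0 ≤ β j) (hγβ : ∀ j, 0 < γ + β j ∧ γ + β j < 1) :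
    -- the two descriptions of the set agree
    (∀ q : ℕ → ℝ, (∀ i, 1 ≤ i → 0 < q i) →
      DiophantineLiminf.approxSet γ β q = DiophantineLiminf.latticeSet γ β q) ∧
    -- some increasing sequence of positive reals gives the stated dimension
    (∃ q : ℕ → ℝ, (∀ i, 1 ≤ i → 0 < q i) ∧ StrictMonoOn q (Set.Ici 1) ∧
      dimH (DiophantineLiminf.approxSet γ β q) =
        ENNReal.ofReal (min (((d : ℝ) + 1) * γ + ∑ j, β j) (d : ℝ))) ∧
    -- every sequence that satisfies the growth condition does
    (∀ q : ℕ → ℝ, DiophantineLiminf.GrowsFast γ β q →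
      dimH (DiophantineLiminf.approxSet γ β q) =
        ENNReal.ofReal (min (((d : ℝ) + 1) * γ + ∑ j, β j) (d : ℝ))) := by
  refine ⟨fun q hq => DiophantineLiminf.approxSet_eq_latticeSet γ β q hq, ?_,
    fun q hq => hq.dimH_approxSet_eq hd hγ hβ hγβ⟩
  obtain ⟨q, hq⟩ := DiophantineLiminf.exists_growsFast γ β
  exact ⟨q, fun i hi => one_pos.trans (hq.1 i hi), hq.2.1,
    hq.dimH_approxSet_eq hd hγ hβ hγβ⟩
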